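/- An \emph{exceptional class} in the $N$-fold blow-up $X_N$ of $\mathbb{CP}^2$ is a class $A=dL-\sum_{i=0}^{N-1} c_iE_i\in H_2(X_N;\mathbb Z)$ (with $L$ the class of a line and $E_i$ the classes of the exceptional divisors) such that $A\cdot A=-1$, $K\cdot A=-1$, that is, $d^2-\sum c_i^2=-1$ and $3d-\sum c_i=1$, and such that $A$ is represented by a smoothly embedded symplectic sphere. For coprime positive integers $p,q$, let $q\mathbf w(p/q)=(m_1,m_2,\dots)$ be the integral weight expansion of $p/q$: it consists of $\lfloor p/q\rfloor$ copies of $q$, followed by the integral weight expansion of $q/(p-\lfloor p/q\rfloor q)$ (which is empty if $q$ divides $p$). We write $(d,m;q\mathbf w(p/q))$ for the class $dL-mE_0-\sum_{i\ge1}m_iE_i$, call $p/q$ its center, and call the class \emph{perfect} if it is exceptional. A sequence of perfect classes $(d_k,m_k;q_k\mathbf w(p_k/q_k))$, $k\ge0$, is a \emph{perfect pre-staircase} with recursion parameter $\sigma$ and linear relation $R_0d=R_1p+R_2q$ if $\sigma\ge0$ is an integer with $\sigma+4$ a perfect square, $x_{k+1}=(\sigma+2)x_k-x_{k-1}$ for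 all $k\ge1$ and each of $x=d,m,p,q$, and $R_0d_k=R_1p_k+R_2q_k$ for all $k\ge0$. \textbf{Proposition.} Each of the following is a perfect pre-staircase with recursion parameter $\sigma_n=(2n+1)(2n+5)$, for each of the two choices $\mathrm{end}_n=2n+4$ and $\mathrm{end}_n=(2n+5,2n+2)$. The centers $p_k/q_k$, $k\ge0$, are given by their continued fractions, where $\{2n+5,2n+1\}^k$ denotes the pair repeated $k$ times; the $d_k$ are defined by the linear relation, and $m_k=3d_k-p_k-q_k$. \begin{itemize} \item $\mathcal S^L_{\ell,n}$, $n\ge0$: centers $[6;2n+1,\{2n+5,2n+1\}^k,\mathrm{end}_n]$, relation $(2n+3)d=(n+1)p-(n-1)q$; \item $\mathcal S^U_{u,n}$, $n\ge0$: centers $[2n+7;\{2n+5,2n+1\}^k,\mathrm{end}_n]$, relation $(2n+3)d=(n+2)p-(n+4)q$; \item $\mathcal S^E_{u,n}$, $n\ge0$: centers $[5;1,2n+6,\{2n+5,2n+1\}^k,\mathrm{end}_n]$, relation $(2n+3)d=-(n+4)p+(11n+31)q$; \item $\mathcal S^L_{u,n}$, $n\ge1$: centers $[6;2n-1,2n+1,\{2n+5,2n+1\}^k,\mathrm{end}_n]$,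 relation $(2n+3)d=-(n-1)p+(11n+2)q$; \item $\mathcal S^U_{\ell,n}$, $n\ge1$: centers $[\{2n+5,2n+1\}^k,\mathrm{end}_n]$, relation $(2n+3)d=(n+1)p+(n+2)q$; \item $\mathcal S^E_{\ell,n}$, $n\ge1$: centers $[5;1,2n+4,2n+1,\{2n+5,2n+1\}^k,\mathrm{end}_n]$, relation $(2n+3)d=(n+2)p-(n+4)q$. \end{itemize} In particular, all the $d_k$ and $m_k$ are integers and all these classes are exceptional. Moreover, with $g_k$ the Fibonacci number $F_{2k+1}$ (so $g_0,g_1,g_2,\dots=1,2,5,13,\dots$), all the classes $\bigl(g_{k+1},0;\,g_k\mathbf w(g_{k+2}/g_k)\bigr)$, $k\ge0$, of the Fibonacci staircase (of which $\mathcal S^L_{\ell,0}$ is a tail) are exceptional, and those with $k$ even and those with $k$ odd each form a perfect pre-staircase with $\sigma=5$ and relation $3d=p+q$. -/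

import Mathlib

open scoped LinearAlgebra.Projectivization ContDiff

/-! ### Blow-ups of the complex projective plane and symplectic spheres in them -/

/-- The complex projective plane. -/
abbrev CP2 : Type := ℙ ℂ (Fin 3 → ℂ)

/-- The `N`-fold blow-up of the plane at the points `p 0, …, p (N - 1)`, as a complex
submanifold of `CP2 × CP2 ^ N`.  It consists of the tuples `(x, ℓ 0, …, ℓ (N - 1))` in which
`ℓ i` is (the equation of) a line through `p i` that also passes through `x`.  The lines through
`p i` form a projective line; away from `p i` the line `ℓ i` is determined by `x`, and the fibre
over `p i` is the exceptional divisor `E i`.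

For distinct points `p i` this is a model of the connected sum of `CP2` with `N` copies of `CP2`
with reversed orientation.  In terms of the basis `L, E 0, …, E (N - 1)` of the second homology,
the projection to the coordinate `x` pulls the hyperplane class back to the class dual to `L`,
and the projection to the coordinate `ℓ i` pulls it back to the class dual to `L - E i`. -/
def blowUp {N : ℕ} (p : Fin N → CP2) : Set (CP2 × (Fin N → CP2)) :=
  {y | ∀ i, Projectivization.orthogonal (y.2 i) (p i) ∧
    Projectivization.orthogonal (y.2 i) y.1}

/-- A smooth map from the two-sphere `ℂ ∪ {∞}` to the projective plane, written in homogeneous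
coordinates: `u` in the chart `z`, and `v` in the chart `w = 1 / z` at infinity.  The exponent of
the transition function says that the pull-back of the hyperplane bundle has degree `deg`, so
`deg` is the degree of the map: the intersection number of its image with a line.  Every smooth
map to the plane is of this form, for exactly one value of `deg`. -/
structure SmoothSphere where
  u : ℂ → Fin 3 → ℂ
  v : ℂ → Fin 3 → ℂ
  smooth_u : ContDiff ℝ ∞ u
  smooth_v : ContDiff ℝ ∞ v
  u_ne_zero : ∀ z, u z ≠ 0
  v_ne_zero : ∀ w, v w ≠ 0
  deg : ℤ
  glue : ∀ z, z ≠ 0 → u z = z ^ deg • v z⁻¹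

/-- The underlying map `ℂ ∪ {∞} → CP2`. -/
noncomputable def SmoothSphere.toMap (f : SmoothSphere) (s : OnePoint ℂ) : CP2 :=
  s.elim (Projectivization.mk ℂ (f.v 0) (f.v_ne_zero 0))
    (fun z => Projectivization.mk ℂ (f.u z) (f.u_ne_zero z))

/-- The Fubini-Study two-form of the projective plane in homogeneous coordinates, at the point
`[u]` and on the tangent vectors represented by `a` and `b`:
`Im (⟨a, b⟩ ⟨u, u⟩ - ⟨a, u⟩ ⟨u, b⟩) / ⟨u, u⟩ ^ 2`. -/
noncomputable def fubiniStudy (u a b : Fin 3 → ℂ) : ℝ :=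
  ((star a ⬝ᵥ b) * (star u ⬝ᵥ u) - (star a ⬝ᵥ u) * (star u ⬝ᵥ b)).im /
    ((star u ⬝ᵥ u).re) ^ 2

/-- The density, with respect to `ds ∧ dt` in the coordinate `z = s + t i`, of the pull-back of the
Fubini-Study form under `z ↦ [u z]`. -/
noncomputable def fsDensity (u : ℂ → Fin 3 → ℂ) (z : ℂ) : ℝ :=
  fubiniStudy (u z) (fderiv ℝ u z 1) (fderiv ℝ u z Complex.I)

/-- The class `d L - ∑ c i E i` in the `N`-fold blow-up of the plane, with `c` the list of its
`N` coefficients, is represented by a smoothly embedded symplectic sphere.  The sphere is given by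
the components `x` and `ℓ i` of a map from `ℂ ∪ {∞}` to the blow-up.  The symplectic form is the
restriction to the blow-up of the sum of the Fubini-Study forms of all the factors; it is a Kähler
form, so its canonical class is the standard one.  A map whose pull-back of this form is
everywhere positive is an orientation-preserving symplectic immersion, and an embedding as soon
as it is injective.  The degrees of the components are the pairings of the class with
`L` and with `L - E i`, namely `d` and `d - c i`; they determine the class. -/
def RepresentedBySymplecticSphere (d : ℤ) (c : List ℤ) : Prop :=
  ∃ p : Fin c.length → CP2, Function.Injective p ∧
    ∃ (x : SmoothSphere) (l : Fin c.length → SmoothSphere),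
      (∀ s, (x.toMap s, fun i => (l i).toMap s) ∈ blowUp p) ∧
      Function.Injective (fun s => (x.toMap s, fun i => (l i).toMap s)) ∧
      (∀ z, 0 < fsDensity x.u z + ∑ i, fsDensity (l i).u z) ∧
      (∀ w, 0 < fsDensity x.v w + ∑ i, fsDensity (l i).v w) ∧
      x.deg = d ∧ ∀ i, (l i).deg = d - c.get i

/-- `(d; c)`, that is the class `A = d L - ∑ c i E i`, is a Diophantine class:
`A · A = -1` and `K · A = -1`. -/
def IsDiophantine (d : ℤ) (c : List ℤ) : Prop :=
  d ^ 2 - (c.map (· ^ 2)).sum = -1 ∧ 3 * d - c.sum = 1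

/-- `(d; c)`, that is the class `A = d L - ∑ c i E i`, is an exceptional class: `A · A = -1`,
`K · A = -1`, and `A` is represented by a smoothly embedded symplectic sphere. -/
def IsExceptional (d : ℤ) (c : List ℤ) : Prop :=
  IsDiophantine d c ∧ RepresentedBySymplecticSphere d c

/-! ### Continued fractions, weight expansions, perfect classes, pre-staircases -/

/-- The numerator and denominator, in lowest terms, of the continued fraction
`[ℓ₀; ℓ₁, …, ℓ_N] = ℓ₀ + 1 / [ℓ₁; …, ℓ_N]`; the empty list stands for `1 / 0`. -/
def contFrac : List ℕ → ℕ × ℕ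
  | [] => (1, 0)
  | a :: l => (a * (contFrac l).1 + (contFrac l).2, (contFrac l).1)

/-- The integral weight expansion `q w(p / q)` of a fraction `p / q` in lowest terms:
`⌊p / q⌋` copies of `q`, followed by the integral weight expansion of `q / (p - ⌊p / q⌋ q)`. -/
def intWeights (p q : ℕ) : List ℤ :=
  if q = 0 then [] else List.replicate (p / q) (q : ℤ) ++ intWeights q (p % q)
termination_by q
decreasing_by exact Nat.mod_lt _ (Nat.pos_of_ne_zero ‹_›)

/-- `(d, m; q w(p / q)) = d L - m E₀ - ∑_{i ≥ 1} m_i E_i`, with `(m₁, m₂, …) = q w(p / q)`, is a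
perfect class with center `p / q`. -/
def IsPerfect (d m : ℤ) (p q : ℕ) : Prop :=
  0 < q ∧ p.Coprime q ∧ IsExceptional d (m :: intWeights p q)

/-- The classes `(d k, m k; q k w(p k / q k))`, for `k ≥ 0`, form a perfect pre-staircase with
recursion parameter `σ` and linear relation `R₀ d = R₁ p + R₂ q`. -/
structure IsPerfectPreStaircase (σ R₀ R₁ R₂ : ℤ) (d m : ℕ → ℤ) (p q : ℕ → ℕ) : Prop where
  sigma_nonneg : 0 ≤ σ
  isSquare : IsSquare (σ + 4)
  recursion_d : ∀ k, d (k + 2) = (σ + 2) * d (k + 1) - d k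
  recursion_m : ∀ k, m (k + 2) = (σ + 2) * m (k + 1) - m k
  recursion_p : ∀ k, (p (k + 2) : ℤ) = (σ + 2) * p (k + 1) - p k
  recursion_q : ∀ k, (q (k + 2) : ℤ) = (σ + 2) * q (k + 1) - q k
  relation : ∀ k, R₀ * d k = R₁ * p k + R₂ * q k
  perfect : ∀ k, IsPerfect (d k) (m k) (p k) (q k)

/-- The continued fraction `[pre, {2n+5, 2n+1}^k, tail]`, where the pair is repeated `k` times. -/
def stairCF (n : ℕ) (pre tail : List ℕ) (k : ℕ) : ℕ × ℕ :=
  contFrac (pre ++ (List.replicate k [2 * n + 5, 2 * n + 1]).flatten ++ tail)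

/-- The pre-staircases with parameter `n`, with centers `[pre, {2n+5, 2n+1}^k, end]`, `k ≥ 0`, and
with linear relation `(2n+3) d = R₁ p + R₂ q` are well defined and perfect, for both choices
`2n+4` and `2n+5, 2n+2` of `end`.  The degrees `d k` are determined by the linear relation, and
the `m k` by the equation `3 d = m + p + q`, which is one of the Diophantine equations. -/
def StaircasePerfect (n : ℕ) (pre : List ℕ) (R₁ R₂ : ℤ) : Prop :=
  ∀ tail ∈ [[2 * n + 4], [2 * n + 5, 2 * n + 2]], ∃ d m : ℕ → ℤ,
    IsPerfectPreStaircase ((2 * n + 1) * (2 * n + 5)) (2 * n + 3) R₁ R₂ d m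
      (fun k => (stairCF n pre tail k).1) (fun k => (stairCF n pre tail k).2)

/-!
A rational curve in a blow-up of the plane is given by sections of line bundles on the Riemann
sphere: its homogeneous coordinates and, for each blown-up point, the directions in which the curve
is seen from it.  If it is embedded, it is a symplectic sphere for a Kähler form on the blow-up.

The quadratic Cremona transformation based at three of the points is a biholomorphism between
blow-ups, so it carries embedded curves to embedded curves.  It also acts on the configurations of
points, as a homeomorphism between open dense sets; hence, if a class is represented by embedded
rational curves for a dense set of configurations, so is its image.  Therefore every class that
arises from that of an exceptional divisor by quadratic transformations, possibly based at further
points of multiplicity zero, is exceptional.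

The composition of de Jonquières transformations, which are compositions of quadratic ones that
share a base point, and of the quintic transformation with six double points carries the class of a
tail of a staircase to that of the tail with `2n+5, 2n+1` prepended, and similarly to the classes of
the six families and of the Fibonacci staircase.  The recursion holds since a continued fraction is
linear in the numerator and denominator of its tail.
-/

open Matrix Polynomial Filter Topology

universe u

/-! ### Vectors of length three -/

section Ring

variable {A B : Type*} [CommRing A] [CommRing B]

theorem eq_or_eq_add_one_or_eq_add_two (j i : Fin 3) : j = i ∨ j = i + 1 ∨ j = i + 2 := by
  decide +revert

theorem cross_apply_cyclic (v w : Fin 3 → A) (j : Fin 3) :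
    (v ⨯₃ w) j = v (j + 1) * w (j + 2) - v (j + 2) * w (j + 1) := by
  fin_cases j <;> simp [cross_apply]

theorem sum_cyclic {M : Type*} [AddCommMonoid M] (f : Fin 3 → M) (j : Fin 3) :
    ∑ i, f i = f j + f (j + 1) + f (j + 2) := by
  rw [Fin.sum_univ_three]
  fin_cases j <;> simp <;> abel

theorem cross_eq_zero_iff {v w : Fin 3 → A} :
    v ⨯₃ w = 0 ↔ ∀ i j, v i * w j = v j * w i := by
  refine ⟨fun h i j => ?_, fun h => ?_⟩
  · have h' := congrFun h
    simp only [cross_apply_cyclic, Pi.zero_apply, sub_eq_zero] at h'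
    have h0 := h' 0
    have h1 := h' 1
    have h2 := h' 2
    fin_cases i <;> fin_cases j <;> simp_all
  · ext j
    rw [cross_apply_cyclic, h, sub_self, Pi.zero_apply]

section RingHomClass

variable {F : Type*} [FunLike F A B] [RingHomClass F A B]

theorem comp_cross (f : F) (v w : Fin 3 → A) : f ∘ (v ⨯₃ w) = (f ∘ v) ⨯₃ (f ∘ w) := by
  ext j
  simp [cross_apply_cyclic]

theorem comp_mulVec (f : F) (M : Matrix (Fin 3) (Fin 3) A) (v : Fin 3 → A) :
    f ∘ (M *ᵥ v) = M.map f *ᵥ (f ∘ v) := by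
  ext j
  simp [mulVec, dotProduct]

end RingHomClass

theorem mulVec_cross_mulVec (M : Matrix (Fin 3) (Fin 3) A) (v w : Fin 3 → A) :
    (M *ᵥ v) ⨯₃ (M *ᵥ w) = M.adjugateᵀ *ᵥ (v ⨯₃ w) := by
  ext j
  fin_cases j <;> simp [cross_apply, mulVec_eq_sum, Fin.sum_univ_three, adjugate_fin_three] <;> ring

theorem mulVec_cross_mulVec_eq_zero (M : Matrix (Fin 3) (Fin 3) A) {v w : Fin 3 → A}
    (h : v ⨯₃ w = 0) : (M *ᵥ v) ⨯₃ (M *ᵥ w) = 0 := by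
  rw [mulVec_cross_mulVec, h, mulVec_zero]

theorem ne_zero_of_cross_eq_zero [IsDomain A] {v w : Fin 3 → A} (hv : ∀ j, v j ≠ 0) (hw : w ≠ 0)
    (h : v ⨯₃ w = 0) (j : Fin 3) : w j ≠ 0 := fun hj =>
  hw <| funext fun k =>
    (mul_eq_zero.1 <| by rw [cross_eq_zero_iff.1 h j k, hj, mul_zero]).resolve_left (hv j)

end Ring

/-! ### Coprimality -/

section Coprime

variable {A : Type u} [CommRing A]

theorem isCoprime_of_forall_field {e f : A}
    (h : ∀ (K : Type u) [Field K] (φ : A →+* K), φ e = 0 → φ f ≠ 0) : IsCoprime e f := by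
  rw [← Ideal.isCoprime_span_singleton_iff, Ideal.isCoprime_iff_sup_eq]
  by_contra hne
  obtain ⟨M, hM, hle⟩ := Ideal.exists_le_maximal _ hne
  let _ := Ideal.Quotient.field M
  rw [sup_le_iff, Ideal.span_singleton_le_iff_mem, Ideal.span_singleton_le_iff_mem] at hle
  exact h (A ⧸ M) (Ideal.Quotient.mk M) (Ideal.Quotient.eq_zero_iff_mem.2 hle.1)
    (Ideal.Quotient.eq_zero_iff_mem.2 hle.2)

theorem exists_common_cofactor {e f a b : A} (h : IsCoprime e f) (hab : e * a = f * b) :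
    ∃ s, a = f * s ∧ b = e * s := by
  obtain ⟨u, v, huv⟩ := h
  refine ⟨u * b + v * a, ?_, ?_⟩
  · linear_combination (-a) * huv + u * hab
  · linear_combination (-b) * huv - v * hab

/-- The entries of `x` have no common zero, so that they are the homogeneous coordinates of a map
to the projective plane.  The zeros are taken in all fields, not only in `ℂ`. -/
def BaseFree (x : Fin 3 → A) : Prop :=
  ∀ (K : Type u) [Field K] (φ : A →+* K), φ ∘ x ≠ 0

theorem BaseFree.of_mulVec {x : Fin 3 → A} (M : Matrix (Fin 3) (Fin 3) A)
    (h : BaseFree (M *ᵥ x)) : BaseFree x := fun K _ φ h0 => h K φ <| by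
  rw [comp_mulVec, h0, mulVec_zero]

end Coprime

/-! ### Sections of line bundles on the Riemann sphere -/

/-- Pairs of polynomials, one for each of the two standard charts of the Riemann sphere. -/
abbrev BiPoly : Type := ℂ[X] × ℂ[X]

namespace BiPoly

/-- The sections of the line bundle of degree `k` on the Riemann sphere, that is, the homogeneous
polynomials of degree `k`, by their expressions in the charts `z` and `1 / z`. -/
def sections (k : ℤ) : Submodule ℂ BiPoly where
  carrier := {a | ∀ z : ℂ, z ≠ 0 → a.1.eval z = z ^ k * a.2.eval z⁻¹}
  add_mem' ha hb z hz := by simp [ha z hz, hb z hz, mul_add]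
  zero_mem' z _ := by simp
  smul_mem' t a ha z hz := by simp [ha z hz, mul_left_comm]

/-- The homogeneous coordinate that vanishes at `0`. -/
noncomputable def T0 : BiPoly := (X, 1)

/-- The homogeneous coordinate that vanishes at `∞`. -/
noncomputable def T1 : BiPoly := (1, X)

/-- The constants, as sections of the line bundle of degree `0`. -/
noncomputable abbrev const : ℂ →+* BiPoly := algebraMap ℂ BiPoly

theorem T0_mem_sections : T0 ∈ sections 1 := fun z _ => by simp [T0]

theorem T1_mem_sections : T1 ∈ sections 1 := fun z hz => by simp [T1, hz]

theorem one_mem_sections : (1 : BiPoly) ∈ sections 0 := fun z _ => by simp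

theorem const_mem_sections (t : ℂ) : const t ∈ sections 0 := by
  rw [Algebra.algebraMap_eq_smul_one]
  exact (sections 0).smul_mem t one_mem_sections

variable {j k k' : ℤ} {a b : BiPoly}

theorem mul_mem_sections (ha : a ∈ sections k) (hb : b ∈ sections k') (h : k + k' = j) :
    a * b ∈ sections j := fun z hz => by
  simp only [Prod.fst_mul, Prod.snd_mul, eval_mul, ha z hz, hb z hz, ← h, zpow_add₀ hz]
  ring

theorem const_mul_mem_sections (t : ℂ) (ha : a ∈ sections k) : const t * a ∈ sections k :=
  mul_mem_sections (const_mem_sections t) ha (zero_add k)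

theorem mem_sections_of_isCoprime {e f s : BiPoly} {k₁ k₂ : ℤ} (he : e ∈ sections k₁)
    (hf : f ∈ sections k₂) (hcop : IsCoprime e f) (hes : e * s ∈ sections (k₁ + k))
    (hfs : f * s ∈ sections (k₂ + k)) : s ∈ sections k := by
  have of_eval_ne_zero : ∀ {e : BiPoly} {k₁ : ℤ}, e ∈ sections k₁ → e * s ∈ sections (k₁ + k) →
      ∀ z : ℂ, z ≠ 0 → e.1.eval z ≠ 0 → s.1.eval z = z ^ k * s.2.eval z⁻¹ := by
    intro e k₁ he hes z hz h0
    have h := hes z hz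
    simp only [Prod.fst_mul, Prod.snd_mul, eval_mul, zpow_add₀ hz] at h
    apply mul_left_cancel₀ h0
    linear_combination h - z ^ k * s.2.eval z⁻¹ * he z hz
  obtain ⟨u, v, huv⟩ := hcop
  intro z hz
  by_cases h : e.1.eval z = 0
  · refine of_eval_ne_zero hf hfs z hz fun h' => ?_
    simpa [h, h'] using congrArg (fun t : BiPoly => t.1.eval z) huv
  · exact of_eval_ne_zero he hes z hz h

end BiPoly

/-! ### Rational curves in blow-ups of the plane -/

open BiPoly

/-- The homogeneous coordinates `x`, `l i` parametrize an embedded rational curve in the blow-up of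
the plane at the points `P i`, of degree `d` and with multiplicity `c i` at `P i`; `e i` is the
pull-back of the section that defines the `i`-th exceptional divisor.  Embeddedness is expressed
in terms of points with values in local rings, among them the dual numbers: this includes that the
curve is immersed. -/
structure IsCurve {ι : Type*} (P : ι → Fin 3 → ℂ) (d : ℤ) (c : ι → ℤ)
    (x : Fin 3 → BiPoly) (e : ι → BiPoly) (l : ι → Fin 3 → BiPoly) : Prop where
  mem_x : ∀ j, x j ∈ sections d
  mem_e : ∀ i, e i ∈ sections (c i)
  mem_l : ∀ i j, l i j ∈ sections (d - c i)
  cross_eq : ∀ i, (const ∘ P i) ⨯₃ x = e i • l i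
  dot_point : ∀ i, l i ⬝ᵥ (const ∘ P i) = 0
  dot_x : ∀ i, l i ⬝ᵥ x = 0
  baseFree_x : BaseFree x
  baseFree_l : ∀ i, BaseFree (l i)
  separates : ∀ (R : Type) [CommRing R] [Algebra ℂ R] [IsLocalRing R] (φ ψ : BiPoly →ₐ[ℂ] R),
    (φ ∘ x) ⨯₃ (ψ ∘ x) = 0 → (∀ i, (φ ∘ l i) ⨯₃ (ψ ∘ l i) = 0) → φ T0 * ψ T1 = φ T1 * ψ T0

/-- There is an embedded rational curve of degree `d` and with multiplicities `c` at `P`. -/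
def HasCurve {ι : Type*} (P : ι → Fin 3 → ℂ) (d : ℤ) (c : ι → ℤ) : Prop :=
  ∃ x e l, IsCurve P d c x e l

theorem HasCurve.reindex {ι κ : Type*} {P : ι → Fin 3 → ℂ} {d : ℤ} {c : ι → ℤ} (σ : κ ≃ ι)
    (h : HasCurve P d c) : HasCurve (P ∘ σ) d (c ∘ σ) := by
  obtain ⟨x, e, l, h⟩ := h
  exact ⟨x, e ∘ σ, l ∘ σ, h.mem_x, fun i => h.mem_e _, fun i => h.mem_l _, fun i => h.cross_eq _,
    fun i => h.dot_point _, fun i => h.dot_x _, h.baseFree_x, fun i => h.baseFree_l _,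
    fun R _ _ _ φ ψ hx hl => h.separates R φ ψ hx (σ.surjective.forall.2 hl)⟩

theorem mulVec_mem_sections {k : ℤ} {y : Fin 3 → BiPoly} (M : Matrix (Fin 3) (Fin 3) ℂ)
    (hy : ∀ j, y j ∈ sections k) (i : Fin 3) : (M.map const *ᵥ y) i ∈ sections k :=
  Submodule.sum_mem _ fun j _ => const_mul_mem_sections (M i j) (hy j)

theorem comp_mulVec_cross_eq_zero {R : Type*} [CommRing R] [Algebra ℂ R] (φ ψ : BiPoly →ₐ[ℂ] R)
    (M : Matrix (Fin 3) (Fin 3) ℂ) {y : Fin 3 → BiPoly} (h : (φ ∘ y) ⨯₃ (ψ ∘ y) = 0) :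
    (φ ∘ (M.map const *ᵥ y)) ⨯₃ (ψ ∘ (M.map const *ᵥ y)) = 0 := by
  have map_const (φ : BiPoly →ₐ[ℂ] R) : (M.map const).map φ = M.map (algebraMap ℂ R) :=
    Matrix.ext fun i j => φ.commutes (M i j)
  rw [comp_mulVec, comp_mulVec, map_const, map_const]
  exact mulVec_cross_mulVec_eq_zero _ h

theorem IsCurve.mulVec {ι : Type*} {P : ι → Fin 3 → ℂ} {d : ℤ} {c : ι → ℤ}
    {x : Fin 3 → BiPoly} {e : ι → BiPoly} {l : ι → Fin 3 → BiPoly} (H : IsCurve P d c x e l)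
    (g h : Matrix (Fin 3) (Fin 3) ℂ) (hgh : h * g = 1) :
    IsCurve (fun i => g *ᵥ P i) d c (g.map const *ᵥ x) (fun i => const g.det * e i)
      (fun i => (hᵀ).map const *ᵥ l i) := by
  have hHG : h.map const * g.map const = 1 := by
    rw [← Matrix.map_mul, hgh, Matrix.map_one _ (map_zero _) (map_one _)]
  have hGH : g.map const * h.map const = 1 := mul_eq_one_comm.1 hHG
  have hx : h.map const *ᵥ (g.map const *ᵥ x) = x := by rw [mulVec_mulVec, hHG, one_mulVec]
  have hl : ∀ i, (gᵀ).map const *ᵥ ((hᵀ).map const *ᵥ l i) = l i := fun i => by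
    rw [mulVec_mulVec, transpose_map, transpose_map, ← transpose_mul, hHG, transpose_one,
      one_mulVec]
  have dot_mulVec : ∀ (v w : Fin 3 → BiPoly),
      ((hᵀ).map const *ᵥ v) ⬝ᵥ (g.map const *ᵥ w) = v ⬝ᵥ w := fun v w => by
    rw [transpose_map, mulVec_transpose, ← dotProduct_mulVec, mulVec_mulVec, hHG, one_mulVec]
  have hadj : (g.map const).adjugate = const g.det • h.map const := by
    rw [RingHom.map_det, RingHom.mapMatrix_apply, ← Matrix.one_mul (h.map const),
      ← smul_mul_assoc, ← adjugate_mul, Matrix.mul_assoc, hGH, Matrix.mul_one]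
  refine ⟨mulVec_mem_sections g H.mem_x, fun i => const_mul_mem_sections _ (H.mem_e i),
    fun i => mulVec_mem_sections hᵀ (H.mem_l i), fun i => ?_, fun i => ?_, fun i => ?_,
    .of_mulVec (h.map const) (by rw [hx]; exact H.baseFree_x),
    fun i => .of_mulVec ((gᵀ).map const) (by rw [hl]; exact H.baseFree_l i),
    fun R _ _ _ φ ψ hpx hpl => H.separates R φ ψ
      (by simpa only [hx] using comp_mulVec_cross_eq_zero φ ψ h hpx)
      fun i => by simpa only [hl] using comp_mulVec_cross_eq_zero φ ψ gᵀ (hpl i)⟩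
  · rw [comp_mulVec, mulVec_cross_mulVec, H.cross_eq, hadj, mulVec_smul, transpose_smul,
      smul_mulVec, ← transpose_map, smul_smul, mul_comm]
  · rw [comp_mulVec, dot_mulVec, H.dot_point]
  · rw [dot_mulVec, H.dot_x]

/-! ### Toric coordinates -/

/-- The coordinate points of the plane. -/
def coordPt (j : Fin 3) : Fin 3 → ℂ := Pi.single j 1

section ToricPoint

variable {A : Type*} [CommRing A] (E s v m : Fin 3 → A) (i : Fin 3)

/-- The homogeneous coordinates on the plane in terms of the toric coordinates on its blow-up at
the coordinate points. -/
def toricPoint : Fin 3 → A := fun j => E (j + 1) * E (j + 2) * s j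

/-- The line through the `i`-th coordinate point and the point with toric coordinates `E`, `s`. -/
def toricLine : Fin 3 → A :=
  Pi.single (i + 2) (E (i + 2) * s (i + 1)) - Pi.single (i + 1) (E (i + 1) * s (i + 2))

@[simp] theorem toricLine_self : toricLine E s i i = 0 := by
  simp [toricLine]

@[simp] theorem toricLine_add_one : toricLine E s i (i + 1) = -(E (i + 1) * s (i + 2)) := by
  simp [toricLine]

@[simp] theorem toricLine_add_two : toricLine E s i (i + 2) = E (i + 2) * s (i + 1) := by
  simp [toricLine]

theorem cross_toricPoint : v ⨯₃ toricPoint E s = E * ((v * E) ⨯₃ s) := by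
  ext j
  fin_cases j <;> simp [cross_apply, toricPoint] <;> ring

theorem single_cross_toricPoint :
    (Pi.single i 1 : Fin 3 → A) ⨯₃ toricPoint E s = E i • toricLine E s i := by
  ext j
  fin_cases i <;> fin_cases j <;> simp [cross_apply, toricPoint, toricLine] <;> ring

theorem toricLine_dot_toricPoint : toricLine E s i ⬝ᵥ toricPoint E s = 0 := by
  fin_cases i <;> simp [toricPoint, toricLine, dotProduct, Fin.sum_univ_three] <;> ring

theorem mul_dot_toricPoint : (E * m) ⬝ᵥ toricPoint E s = (E 0 * E 1 * E 2) * (s ⬝ᵥ m) := by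
  simp [toricPoint, dotProduct, Fin.sum_univ_three]
  ring

end ToricPoint

section Hexagonal

variable {A : Type u} [CommRing A] {K : Type*} [Field K]

/-- Among the exceptional curves over the coordinate points of the plane (with equations `E j`) and
the lines through pairs of coordinate points (with equations `s j`), which form a hexagon, only the
neighbours `E j` and `s k` with `j ≠ k` meet. -/
def Hexagonal (E s : Fin 3 → A) : Prop :=
  ∀ j k, j ≠ k → IsCoprime (E j * s k) (E k * s j)

variable {E s m : Fin 3 → A}

theorem Hexagonal.symm (h : Hexagonal E s) : Hexagonal s E := fun j k hjk => by
  simpa only [mul_comm] using h k j hjk.symm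

theorem Hexagonal.map {B : Type*} [CommRing B] (h : Hexagonal E s) (φ : A →+* B) :
    Hexagonal (φ ∘ E) (φ ∘ s) := fun j k hjk => by
  simpa using (h j k hjk).map φ

theorem hexagonal_of_cyclic (h : ∀ i, IsCoprime (E (i + 1) * s (i + 2)) (E (i + 2) * s (i + 1))) :
    Hexagonal E s := fun j k hjk => by
  have : ∃ i : Fin 3, (j = i + 1 ∧ k = i + 2) ∨ (j = i + 2 ∧ k = i + 1) := by decide +revert
  obtain ⟨i, ⟨rfl, rfl⟩ | ⟨rfl, rfl⟩⟩ := this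
  exacts [h i, (h i).symm]

theorem Hexagonal.ne_zero_of_eq_zero {E s : Fin 3 → K} (h : Hexagonal E s) {j : Fin 3}
    (hj : E j = 0) :
    s j ≠ 0 ∧ ∀ k ≠ j, E k ≠ 0 := by
  have ne_zero : ∀ k ≠ j, E k * s j ≠ 0 := fun k hk h0 => by
    simpa [hj, h0] using (h j k hk.symm).ne_zero_or_ne_zero
  exact ⟨right_ne_zero_of_mul (ne_zero (j + 1) (by simp)),
    fun k hk => left_ne_zero_of_mul (ne_zero k hk)⟩

theorem Hexagonal.ne_zero_of_forall {E s : Fin 3 → K} (h : Hexagonal E s)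
    (hEs : ∀ j k, E j * s k = 0 → E k * s j = 0) (j : Fin 3) : s j ≠ 0 := by
  refine right_ne_zero_of_mul (a := E (j + 1)) fun h0 => ?_
  simpa [h0, hEs _ _ h0] using (h (j + 1) j (by simp)).ne_zero_or_ne_zero

theorem Hexagonal.baseFree_toricPoint (h : Hexagonal E s) : BaseFree (toricPoint E s) := by
  intro K _ φ hx
  have hx' : ∀ j, φ (E (j + 1)) * φ (E (j + 2)) * φ (s j) = 0 := fun j => by
    simpa [toricPoint] using congrFun hx j
  have hEs := h.map φ
  have hE : ∀ j, φ (E j) ≠ 0 := fun j hj => by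
    obtain ⟨hs, hE⟩ := hEs.ne_zero_of_eq_zero hj
    exact mul_ne_zero (mul_ne_zero (hE _ (by simp)) (hE _ (by simp))) hs (hx' j)
  have hs : ∀ j, φ (s j) = 0 := fun j =>
    (mul_eq_zero.1 (hx' j)).resolve_left (mul_ne_zero (hE _) (hE _))
  exact (hEs.symm.ne_zero_of_eq_zero (hs 0)).2 1 (by simp) (hs 1)

theorem Hexagonal.baseFree_toricLine (h : Hexagonal E s) (i : Fin 3) :
    BaseFree (toricLine E s i) := by
  intro K _ φ hl
  have h1 : φ (E (i + 1) * s (i + 2)) = 0 := by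
    simpa using congrFun hl (i + 1)
  have h2 : φ (E (i + 2) * s (i + 1)) = 0 := by
    simpa using congrFun hl (i + 2)
  simpa [h1, h2] using ((h (i + 1) (i + 2) (by simp)).map φ).ne_zero_or_ne_zero

theorem Hexagonal.baseFree_mul (h : Hexagonal E s) (hm : BaseFree m) (hsm : s ⬝ᵥ m = 0) :
    BaseFree (E * m) := by
  intro K _ φ hl
  refine hm K φ (funext fun j => by_contra fun hmj => ?_)
  have hEm : ∀ k, φ (E k) * φ (m k) = 0 := fun k => by simpa using congrFun hl k
  obtain ⟨hs, hE⟩ := (h.map φ).ne_zero_of_eq_zero ((mul_eq_zero.1 (hEm j)).resolve_right hmj)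
  have hmk : ∀ k ≠ j, φ (m k) = 0 := fun k hk => (mul_eq_zero.1 (hEm k)).resolve_left (hE k hk)
  have hsm' : φ (s j) * φ (m j) = 0 := by
    simpa [dotProduct, sum_cyclic _ j, hmk] using congrArg φ hsm
  exact mul_ne_zero hs hmj hsm'

end Hexagonal

/-- Homogeneous coordinates of an embedded rational curve in the blow-up of the plane at the
coordinate points and at the points `Q i`: the pull-backs `E j`, `s j` and `e i` of the equations of
the exceptional curves over the coordinate points, of the lines through pairs of these and of the
exceptional curves over the `Q i`.  The line through the point of the curve and `Q i` has the
equation `E * m i`, and the line through its image under the Cremona transformation, which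
exchanges `E` and `s`, and the image of `Q i` is `s * m i`, up to constant factors. -/
structure IsToricCurve {κ : Type*} (Q : κ → Fin 3 → ℂ) (d : ℤ) (a : Fin 3 → ℤ) (b : κ → ℤ)
    (E s : Fin 3 → BiPoly) (e : κ → BiPoly) (m : κ → Fin 3 → BiPoly) : Prop where
  mem_E : ∀ j, E j ∈ sections (a j)
  mem_s : ∀ j, s j ∈ sections (d - ∑ i, a i + a j)
  mem_e : ∀ i, e i ∈ sections (b i)
  mem_m : ∀ i j, m i j ∈ sections (d - b i - a j)
  cross_eq : ∀ i, (const ∘ Q i * E) ⨯₃ s = e i • m i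
  s_dot : ∀ i, s ⬝ᵥ m i = 0
  E_dot : ∀ i, (E * m i) ⬝ᵥ (const ∘ Q i) = 0
  hexagonal : Hexagonal E s
  baseFree : ∀ i, BaseFree (m i)
  separates : ∀ (R : Type) [CommRing R] [Algebra ℂ R] [IsLocalRing R] (φ ψ : BiPoly →ₐ[ℂ] R),
    (∀ j k, φ (E j * s k) * ψ (E k * s j) = φ (E k * s j) * ψ (E j * s k)) →
    (∀ i, (φ ∘ (E * m i)) ⨯₃ (ψ ∘ (E * m i)) = 0) → φ T0 * ψ T1 = φ T1 * ψ T0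

theorem const_comp_coordPt (j : Fin 3) : const ∘ coordPt j = Pi.single j 1 := by
  ext1 k
  rw [Function.comp_apply, coordPt, Pi.single_apply, Pi.single_apply, apply_ite const, map_one,
    map_zero]

section Curves

variable {κ : Type*} {Q : κ → Fin 3 → ℂ} {d : ℤ} {a : Fin 3 → ℤ} {b : κ → ℤ}

namespace IsToricCurve

variable {E s : Fin 3 → BiPoly} {e : κ → BiPoly} {m : κ → Fin 3 → BiPoly}

theorem toricPoint_mem_sections (H : IsToricCurve Q d a b E s e m) (j : Fin 3) :
    toricPoint E s j ∈ sections d :=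
  mul_mem_sections (mul_mem_sections (H.mem_E _) (H.mem_E _) rfl) (H.mem_s j) <| by
    rw [sum_cyclic a j]; ring

theorem toricLine_mem_sections (H : IsToricCurve Q d a b E s e m) (i j : Fin 3) :
    toricLine E s i j ∈ sections (d - a i) := by
  obtain rfl | rfl | rfl := eq_or_eq_add_one_or_eq_add_two j i
  · simp
  · rw [toricLine_add_one]
    exact neg_mem (mul_mem_sections (H.mem_E _) (H.mem_s _) (by rw [sum_cyclic a i]; ring))
  · rw [toricLine_add_two]
    exact mul_mem_sections (H.mem_E _) (H.mem_s _) (by rw [sum_cyclic a i]; ring)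

theorem isCurve (H : IsToricCurve Q d a b E s e m) :
    IsCurve (Sum.elim coordPt Q) d (Sum.elim a b) (toricPoint E s) (Sum.elim E e)
      (Sum.elim (toricLine E s) fun i => E * m i) where
  mem_x := H.toricPoint_mem_sections
  mem_e := Sum.rec H.mem_E H.mem_e
  mem_l := Sum.rec H.toricLine_mem_sections fun i j =>
    mul_mem_sections (H.mem_E j) (H.mem_m i j) (by simp)
  cross_eq := by
    rintro (i | i)
    · simp only [Sum.elim_inl, const_comp_coordPt, single_cross_toricPoint]
    · simp only [Sum.elim_inr, cross_toricPoint, H.cross_eq, mul_smul_comm]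
  dot_point := by
    rintro (i | i)
    · simp [const_comp_coordPt]
    · exact H.E_dot i
  dot_x := by
    rintro (i | i)
    · exact toricLine_dot_toricPoint E s i
    · simp only [Sum.elim_inr, mul_dot_toricPoint, H.s_dot, mul_zero]
  baseFree_x := H.hexagonal.baseFree_toricPoint
  baseFree_l := Sum.rec H.hexagonal.baseFree_toricLine fun i =>
    H.hexagonal.baseFree_mul (H.baseFree i) (H.s_dot i)
  separates R _ _ _ φ ψ _ hl := H.separates R φ ψ (fun j k => by
    have cyclic : ∀ i, φ (E (i + 1) * s (i + 2)) * ψ (E (i + 2) * s (i + 1)) =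
        φ (E (i + 2) * s (i + 1)) * ψ (E (i + 1) * s (i + 2)) := fun i => by
      simpa using cross_eq_zero_iff.1 (hl (.inl i)) (i + 1) (i + 2)
    have : ∃ i : Fin 3, j = k ∨ (j = i + 1 ∧ k = i + 2) ∨ (j = i + 2 ∧ k = i + 1) := by
      decide +revert
    obtain ⟨i, rfl | ⟨rfl, rfl⟩ | ⟨rfl, rfl⟩⟩ := this
    exacts [rfl, cyclic i, (cyclic i).symm]) fun i => hl (.inr i)

end IsToricCurve

namespace IsCurve

variable {x : Fin 3 → BiPoly} {e : Fin 3 ⊕ κ → BiPoly} {l : Fin 3 ⊕ κ → Fin 3 → BiPoly}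

theorem single_cross (H : IsCurve (Sum.elim coordPt Q) d (Sum.elim a b) x e l) (j : Fin 3) :
    (Pi.single j 1) ⨯₃ x = e (.inl j) • l (.inl j) := by
  simpa only [Sum.elim_inl, const_comp_coordPt] using H.cross_eq (.inl j)

theorem apply_eq_neg (H : IsCurve (Sum.elim coordPt Q) d (Sum.elim a b) x e l) (j : Fin 3) :
    x j = -(e (.inl (j + 1)) * l (.inl (j + 1)) (j + 2)) := by
  have h := congrFun (H.single_cross (j + 1)) (j + 2)
  rw [cross_apply_cyclic] at h
  fin_cases j <;> simpa [neg_eq_iff_eq_neg] using h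

theorem apply_eq (H : IsCurve (Sum.elim coordPt Q) d (Sum.elim a b) x e l) (j : Fin 3) :
    x j = e (.inl (j + 2)) * l (.inl (j + 2)) (j + 1) := by
  have h := congrFun (H.single_cross (j + 2)) (j + 1)
  rw [cross_apply_cyclic] at h
  fin_cases j <;> simpa using h

theorem map_eq_zero_of_ne (H : IsCurve (Sum.elim coordPt Q) d (Sum.elim a b) x e l)
    {K : Type*} [Field K] (φ : BiPoly →+* K) {j k : Fin 3} (hj : φ (e (.inl j)) = 0)
    (hjk : j ≠ k) : φ (x k) = 0 := by
  obtain rfl | rfl := (eq_or_eq_add_one_or_eq_add_two j k).resolve_left hjk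
  · rw [H.apply_eq_neg, map_neg, map_mul, hj, zero_mul, neg_zero]
  · rw [H.apply_eq, map_mul, hj, zero_mul]

theorem isCoprime_inl (H : IsCurve (Sum.elim coordPt Q) d (Sum.elim a b) x e l) {j k : Fin 3}
    (hjk : j ≠ k) : IsCoprime (e (.inl j)) (e (.inl k)) :=
  isCoprime_of_forall_field fun K _ φ hj hk => H.baseFree_x K φ <| funext fun i => by
    by_cases hi : j = i
    · exact H.map_eq_zero_of_ne φ hk (hi ▸ hjk.symm)
    · exact H.map_eq_zero_of_ne φ hj hi

theorem isCoprime_inr_inl (H : IsCurve (Sum.elim coordPt Q) d (Sum.elim a b) x e l)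
    (hQ : ∀ i j, Q i j ≠ 0) (i : κ) (j : Fin 3) : IsCoprime (e (.inr i)) (e (.inl j)) :=
  isCoprime_of_forall_field fun K _ φ hi hj => by
    have hcross : (φ ∘ const ∘ Q i) ⨯₃ (φ ∘ x) = 0 := by
      have := congrArg (φ ∘ ·) (H.cross_eq (.inr i))
      simpa [comp_cross, hi, funext_iff] using this
    exact ne_zero_of_cross_eq_zero (fun k => ((hQ i k).isUnit.map (φ.comp const)).ne_zero)
      (H.baseFree_x K φ) hcross (j + 1) (H.map_eq_zero_of_ne φ hj (by simp))

theorem line_self (H : IsCurve (Sum.elim coordPt Q) d (Sum.elim a b) x e l) (j : Fin 3) :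
    l (.inl j) j = 0 := by
  simpa [const_comp_coordPt] using H.dot_point (.inl j)

theorem exists_toricPoint (H : IsCurve (Sum.elim coordPt Q) d (Sum.elim a b) x e l) :
    ∃ s, x = toricPoint (e ∘ .inl) s ∧ l ∘ .inl = toricLine (e ∘ .inl) s ∧
      ∀ j, s j ∈ sections (d - ∑ i, a i + a j) := by
  have cop : ∀ j : Fin 3, IsCoprime (e (.inl (j + 1))) (e (.inl (j + 2))) := fun j =>
    H.isCoprime_inl (by simp)
  choose s hs1 hs2 using fun j => exists_common_cofactor (cop j)
    (show e (.inl (j + 1)) * -l (.inl (j + 1)) (j + 2) =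
      e (.inl (j + 2)) * l (.inl (j + 2)) (j + 1) by rw [mul_neg, ← H.apply_eq_neg, H.apply_eq])
  refine ⟨s, funext fun j => ?_, funext fun i => funext fun k => ?_, fun j => ?_⟩
  · rw [H.apply_eq, hs2, toricPoint, Function.comp_apply, Function.comp_apply]
    ring
  · obtain rfl | rfl | rfl := eq_or_eq_add_one_or_eq_add_two k i
    · rw [toricLine_self, Function.comp_apply, H.line_self]
    · rw [toricLine_add_one, eq_comm, neg_eq_iff_eq_neg]
      simpa [add_assoc] using (hs1 (i + 2)).symm
    · rw [toricLine_add_two]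
      simpa [add_assoc] using hs2 (i + 1)
  · refine mem_sections_of_isCoprime (H.mem_e (.inl (j + 1))) (H.mem_e (.inl (j + 2))) (cop j) ?_ ?_
    · rw [← hs2]
      convert H.mem_l (.inl (j + 2)) (j + 1) using 2
      simp [sum_cyclic a j]
      ring
    · rw [← hs1]
      convert neg_mem (H.mem_l (.inl (j + 1)) (j + 2)) using 2
      simp [sum_cyclic a j]
      ring

end IsCurve

end Curves

section ToricCross

variable {A R F : Type*} [CommRing A] [CommRing R] [FunLike F A R] [RingHomClass F A R]
  {E s E' s' : Fin 3 → R}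

theorem comp_toricPoint (φ : F) (E s : Fin 3 → A) :
    φ ∘ toricPoint E s = toricPoint (φ ∘ E) (φ ∘ s) := by
  ext j
  simp [toricPoint]

theorem comp_toricLine (φ : F) (E s : Fin 3 → A) (i : Fin 3) :
    φ ∘ toricLine E s i = toricLine (φ ∘ E) (φ ∘ s) i := by
  ext j
  obtain rfl | rfl | rfl := eq_or_eq_add_one_or_eq_add_two j i <;> simp

theorem toricPoint_cross_toricPoint_eq_zero
    (h : ∀ j k, E j * s k * (E' k * s' j) = E k * s j * (E' j * s' k)) :
    toricPoint E s ⨯₃ toricPoint E' s' = 0 := by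
  ext i
  rw [cross_apply_cyclic, Pi.zero_apply]
  fin_cases i <;> simp only [toricPoint] <;> simp
  · linear_combination (E 0 * E' 0) * h 2 1
  · linear_combination (E 1 * E' 1) * h 0 2
  · linear_combination (E 2 * E' 2) * h 1 0

theorem toricLine_cross_toricLine_eq_zero
    (h : ∀ j k, E j * s k * (E' k * s' j) = E k * s j * (E' j * s' k)) (i : Fin 3) :
    toricLine E s i ⨯₃ toricLine E' s' i = 0 := by
  ext j
  rw [cross_apply_cyclic, Pi.zero_apply]
  obtain rfl | rfl | rfl := eq_or_eq_add_one_or_eq_add_two j i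
  · simp [h (j + 1) (j + 2)]
  · simp [add_assoc]
  · simp [add_assoc]

theorem cross_cross_cross_eq_zero (t : Fin 3 → R) {v w : Fin 3 → R} (h : v ⨯₃ w = 0) :
    (t ⨯₃ v) ⨯₃ (t ⨯₃ w) = 0 := by
  rw [cross_cross_eq_smul_sub_smul, dot_self_cross, triple_product_permutation, ← cross_anticomm, h]
  simp

theorem cross_eq_zero_of_mul {t v w : Fin 3 → R} (ht : ∀ j, IsUnit (t j))
    (h : (t * v) ⨯₃ (t * w) = 0) : v ⨯₃ w = 0 :=
  cross_eq_zero_iff.2 fun j k => ((ht j).mul (ht k)).mul_left_cancel <| by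
    have := cross_eq_zero_iff.1 h j k
    simp only [Pi.mul_apply] at this
    linear_combination this

end ToricCross

section Curves

variable {κ : Type*} {Q : κ → Fin 3 → ℂ} {d : ℤ} {a : Fin 3 → ℤ} {b : κ → ℤ}

namespace IsCurve

variable {x s : Fin 3 → BiPoly} {e : Fin 3 ⊕ κ → BiPoly} {l : Fin 3 ⊕ κ → Fin 3 → BiPoly}

theorem hexagonal (H : IsCurve (Sum.elim coordPt Q) d (Sum.elim a b) x e l)
    (hl : l ∘ .inl = toricLine (e ∘ .inl) s) : Hexagonal (e ∘ .inl) s :=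
  hexagonal_of_cyclic fun i => isCoprime_of_forall_field fun K _ φ h1 h2 =>
    H.baseFree_l (.inl i) K φ <| by
      rw [← Function.comp_apply (f := l), hl]
      ext j
      obtain rfl | rfl | rfl := eq_or_eq_add_one_or_eq_add_two j i
      · simp
      · simpa using h1
      · simpa using h2

theorem exists_line_eq_mul (H : IsCurve (Sum.elim coordPt Q) d (Sum.elim a b) x e l)
    (hQ : ∀ i j, Q i j ≠ 0) (hx : x = toricPoint (e ∘ .inl) s) (i : κ) :
    ∃ m, l (.inr i) = e ∘ .inl * m ∧ (const ∘ Q i * e ∘ .inl) ⨯₃ s = e (.inr i) • m := by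
  have hcross : e (.inr i) • l (.inr i) = e ∘ .inl * ((const ∘ Q i * e ∘ .inl) ⨯₃ s) := by
    rw [← cross_toricPoint, ← hx]
    exact (H.cross_eq (.inr i)).symm
  choose m hm1 hm2 using fun j =>
    exists_common_cofactor (H.isCoprime_inr_inl hQ i j) (congrFun hcross j)
  exact ⟨m, funext hm1, funext hm2⟩

theorem exists_isToricCurve (H : IsCurve (Sum.elim coordPt Q) d (Sum.elim a b) x e l)
    (hQ : ∀ i j, Q i j ≠ 0) :
    ∃ s m, IsToricCurve Q d a b (e ∘ .inl) s (e ∘ .inr) m := by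
  obtain ⟨s, hx, hl, hs⟩ := H.exists_toricPoint
  choose m hm hcross using H.exists_line_eq_mul hQ hx
  refine ⟨s, m, fun j => H.mem_e (.inl j), hs, fun i => H.mem_e (.inr i), fun i j => ?_, hcross,
    fun i => ?_, fun i => ?_, H.hexagonal hl, fun i K _ φ h0 => ?_, fun R _ _ _ φ ψ hEs hφψ => ?_⟩
  · refine mem_sections_of_isCoprime (H.mem_e (.inr i)) (H.mem_e (.inl j))
      (H.isCoprime_inr_inl hQ i j) ?_ ?_
    · rw [← smul_eq_mul, ← Pi.smul_apply, ← hcross, cross_apply_cyclic]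
      refine sub_mem (mul_mem_sections (const_mul_mem_sections _ (H.mem_e (.inl _))) (hs _) ?_)
        (mul_mem_sections (const_mul_mem_sections _ (H.mem_e (.inl _))) (hs _) ?_) <;>
      · simp only [Sum.elim_inl, Sum.elim_inr, sum_cyclic a j]
        ring
    · convert H.mem_l (.inr i) j using 2
      · simp
      · simp [hm]
  · have he : e (.inr i) * (s ⬝ᵥ m i) = 0 := by
      rw [← smul_eq_mul, ← dotProduct_smul, ← hcross, dot_cross_self]
    have hE : (e (.inl 0) * e (.inl 1) * e (.inl 2)) * (s ⬝ᵥ m i) = 0 := by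
      have := H.dot_x (.inr i)
      rwa [hm, hx, mul_dot_toricPoint] at this
    have cop := H.isCoprime_inr_inl hQ i
    obtain ⟨u, v, huv⟩ := ((cop 0).mul_right (cop 1)).mul_right (cop 2)
    linear_combination (-(s ⬝ᵥ m i)) * huv + u * he + v * hE
  · rw [← hm]
    exact H.dot_point (.inr i)
  · refine H.baseFree_l (.inr i) K φ ?_
    rw [hm]
    ext j
    simpa using .inr (congrFun h0 j)
  · have hEs' := fun j k => by simpa only [map_mul] using hEs j k
    refine H.separates R φ ψ ?_ (Sum.rec (fun i => ?_) fun i => ?_)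
    · rw [hx, comp_toricPoint, comp_toricPoint]
      exact toricPoint_cross_toricPoint_eq_zero hEs'
    · rw [← Function.comp_apply (f := l), hl, comp_toricLine, comp_toricLine]
      exact toricLine_cross_toricLine_eq_zero hEs' i
    · rw [hm]
      exact hφψ i

end IsCurve

/-! ### The Cremona transformation -/

section CremonaScale

variable {A : Type*} [CommRing A] {t u : Fin 3 → A}

/-- For `u` the inverse of a point of the plane, the factor by which the Cremona transformation
changes the equations of the lines through the point, in toric coordinates. -/
def cremonaScale (u : Fin 3 → A) : Fin 3 → A := fun j => -(u (j + 1) * u (j + 2))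

theorem comp_cremonaScale {R F : Type*} [CommRing R] [FunLike F A R] [RingHomClass F A R] (φ : F)
    (u : Fin 3 → A) : φ ∘ cremonaScale u = cremonaScale (φ ∘ u) := by
  ext j
  simp [cremonaScale]

theorem isUnit_cremonaScale (hu : ∀ j, IsUnit (u j)) (j : Fin 3) : IsUnit (cremonaScale u j) :=
  ((hu _).mul (hu _)).neg

theorem mul_cross_eq_cremonaScale_mul (h : u * t = 1) (v w : Fin 3 → A) :
    (u * v) ⨯₃ w = cremonaScale u * ((t * w) ⨯₃ v) := by
  ext j
  have hj := fun j => congrFun h j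
  simp only [cross_apply_cyclic, cremonaScale, Pi.mul_apply, Pi.one_apply] at hj ⊢
  linear_combination u (j + 2) * w (j + 1) * v (j + 2) * hj (j + 1) -
    u (j + 1) * w (j + 2) * v (j + 1) * hj (j + 2)

theorem dot_cremonaScale_mul (h : u * t = 1) (v w : Fin 3 → A) :
    v ⬝ᵥ (cremonaScale u * w) = -(u 0 * u 1 * u 2) * ((v * w) ⬝ᵥ t) := by
  have hj := fun j => congrFun h j
  simp only [dotProduct, Fin.sum_univ_three, cremonaScale, Pi.mul_apply, Pi.one_apply, zero_add,
    Fin.reduceAdd] at hj ⊢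
  linear_combination u 1 * u 2 * v 0 * w 0 * hj 0 + u 2 * u 0 * v 1 * w 1 * hj 1 +
    u 0 * u 1 * v 2 * w 2 * hj 2

theorem mul_cremonaScale_mul_dot (u v w : Fin 3 → A) :
    (v * (cremonaScale u * w)) ⬝ᵥ u = -(u 0 * u 1 * u 2) * (v ⬝ᵥ w) := by
  simp only [dotProduct, Fin.sum_univ_three, cremonaScale, Pi.mul_apply, zero_add, Fin.reduceAdd]
  ring

end CremonaScale

namespace IsToricCurve

variable {E s : Fin 3 → BiPoly} {e : κ → BiPoly} {m : κ → Fin 3 → BiPoly}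

theorem smul_mul_eq_cross (H : IsToricCurve Q d a b E s e m) (i : κ) :
    e i • (E * m i) = (const ∘ Q i) ⨯₃ toricPoint E s := by
  rw [cross_toricPoint, H.cross_eq, mul_smul_comm]

theorem ne_zero_of_map_eq_zero (H : IsToricCurve Q d a b E s e m) {i : κ} (hQ : ∀ j, Q i j ≠ 0)
    {K : Type*} [Field K] (φ : BiPoly →+* K) (hi : φ (e i) = 0) (j : Fin 3) :
    φ (E j) ≠ 0 ∧ φ (s j) ≠ 0 := by
  have hQ' : ∀ j, φ (const (Q i j)) ≠ 0 := fun j =>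
    ((hQ j).isUnit.map (φ.comp const)).ne_zero
  have hcross : (φ ∘ (const ∘ Q i * E)) ⨯₃ (φ ∘ s) = 0 := by
    have := congrArg (φ ∘ ·) (H.cross_eq i)
    simpa [comp_cross, hi, funext_iff] using this
  have hEs : ∀ j k, φ (E j) * φ (s k) = 0 → φ (E k) * φ (s j) = 0 := fun j k h0 => by
    have h := cross_eq_zero_iff.1 hcross k j
    simp only [Function.comp_apply, Pi.mul_apply, map_mul, mul_assoc, h0, mul_zero] at h
    exact (mul_eq_zero.1 h).resolve_left (hQ' k)
  have hex := H.hexagonal.map φ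
  exact ⟨hex.symm.ne_zero_of_forall (fun j k => by
    simpa only [Function.comp_apply, mul_comm] using hEs k j) j,
    hex.ne_zero_of_forall hEs j⟩

theorem isUnit_of_not_isUnit (H : IsToricCurve Q d a b E s e m) {i : κ} (hQ : ∀ j, Q i j ≠ 0)
    {R : Type*} [CommRing R] [IsLocalRing R] (φ ψ : BiPoly →+* R)
    (hEs : ∀ j k, φ (E j * s k) * ψ (E k * s j) = φ (E k * s j) * ψ (E j * s k))
    (hi : ¬ IsUnit (φ (e i))) (j : Fin 3) : IsUnit (φ (s j)) ∧ IsUnit (ψ (s j)) := by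
  let π := IsLocalRing.residue R
  have hne := H.ne_zero_of_map_eq_zero hQ (π.comp φ)
    (not_not.1 (mt (IsLocalRing.residue_ne_zero_iff_isUnit _).1 hi))
  simp only [← IsLocalRing.residue_ne_zero_iff_isUnit]
  refine ⟨(hne j).2, (H.hexagonal.map (π.comp ψ)).ne_zero_of_forall (fun j k h0 => ?_) j⟩
  have h := congrArg π (hEs j k)
  simp only [map_mul] at h
  have h0' : π (ψ (E j)) * π (ψ (s k)) = 0 := h0
  rw [h0', mul_zero] at h
  exact (mul_eq_zero.1 h).resolve_left (mul_ne_zero (hne j).1 (hne k).2)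

theorem mul_cross_mul_eq_zero (H : IsToricCurve Q d a b E s e m) {i : κ} (hQ : ∀ j, Q i j ≠ 0)
    {R : Type*} [CommRing R] [Algebra ℂ R] [IsLocalRing R] (φ ψ : BiPoly →ₐ[ℂ] R)
    (hEs : ∀ j k, φ (E j * s k) * ψ (E k * s j) = φ (E k * s j) * ψ (E j * s k))
    (hsm : (φ ∘ (s * m i)) ⨯₃ (ψ ∘ (s * m i)) = 0) :
    (φ ∘ (E * m i)) ⨯₃ (ψ ∘ (E * m i)) = 0 := by
  by_cases he : IsUnit (φ (e i)) ∧ IsUnit (ψ (e i))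
  · have smul_comp (φ : BiPoly →ₐ[ℂ] R) : φ (e i) • (φ ∘ (E * m i)) =
        (algebraMap ℂ R ∘ Q i) ⨯₃ toricPoint (φ ∘ E) (φ ∘ s) := by
      have : φ ∘ const ∘ Q i = algebraMap ℂ R ∘ Q i := funext fun j => φ.commutes _
      rw [← comp_toricPoint, ← this, ← comp_cross, ← H.smul_mul_eq_cross]
      ext j
      simp
    have hx := toricPoint_cross_toricPoint_eq_zero (E := φ ∘ E) (E' := ψ ∘ E) (s := φ ∘ s)
      (s' := ψ ∘ s) fun j k => by
        simpa only [Function.comp_apply, map_mul] using hEs j k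
    have h := cross_cross_cross_eq_zero (algebraMap ℂ R ∘ Q i) hx
    rw [← smul_comp, ← smul_comp, map_smul, LinearMap.map_smul₂, smul_smul] at h
    exact (he.2.mul he.1).smul_left_cancel.1 (h.trans (smul_zero _).symm)
  · have hs : ∀ j, IsUnit (φ (s j)) ∧ IsUnit (ψ (s j)) := fun j => by
      obtain h | h := not_and_or.1 he
      · exact H.isUnit_of_not_isUnit hQ (φ : BiPoly →+* R) ψ hEs h j
      · exact (H.isUnit_of_not_isUnit hQ (ψ : BiPoly →+* R) φ
          (fun j k => by simpa only [RingHom.coe_coe, mul_comm] using hEs k j) h j).symm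
    refine cross_eq_zero_iff.2 fun j k => ((hs k).1.mul (hs j).2).mul_left_cancel ?_
    have h1 := cross_eq_zero_iff.1 hsm j k
    have h2 := hEs j k
    simp only [Function.comp_apply, Pi.mul_apply, map_mul] at h1 h2 ⊢
    linear_combination (φ (m i j) * ψ (m i k)) * h2 + (φ (E k) * ψ (E j)) * h1

theorem cremona (H : IsToricCurve Q d a b E s e m) (hQ : ∀ i j, Q i j ≠ 0) :
    IsToricCurve Q⁻¹ (2 * d - ∑ j, a j) (fun j => d - ∑ i, a i + a j) b s E e
      (fun i => cremonaScale (const ∘ (Q i)⁻¹) * m i) := by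
  have inv_mul : ∀ i, (const ∘ (Q i)⁻¹) * (const ∘ Q i) = 1 := fun i => funext fun j => by
    rw [Pi.mul_apply, Function.comp_apply, Function.comp_apply, ← map_mul, Pi.inv_apply,
      inv_mul_cancel₀ (hQ i j), map_one, Pi.one_apply]
  have isUnit_map : ∀ {R : Type} [CommRing R] (φ : ℂ →+* R) i j,
      IsUnit (cremonaScale (φ ∘ (Q i)⁻¹) j) := fun φ i =>
    isUnit_cremonaScale fun j => (inv_ne_zero (hQ i j)).isUnit.map φ
  refine ⟨H.mem_s, fun j => ?_, H.mem_e, fun i j => ?_, fun i => ?_, fun i => ?_, fun i => ?_,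
    H.hexagonal.symm, fun i K _ φ h0 => ?_, fun R _ _ _ φ ψ hEs hsm => ?_⟩
  · convert H.mem_E j using 2
    simp only [Fin.sum_univ_three]
    ring
  · rw [Pi.mul_apply, cremonaScale, neg_mul, mul_assoc]
    refine neg_mem (const_mul_mem_sections _ (const_mul_mem_sections _ ?_))
    convert H.mem_m i j using 2
    ring
  · exact (mul_cross_eq_cremonaScale_mul (inv_mul i) s E).trans (by rw [H.cross_eq, mul_smul_comm])
  · rw [dot_cremonaScale_mul (inv_mul i), H.E_dot, mul_zero]
  · exact (mul_cremonaScale_mul_dot _ s (m i)).trans (by rw [H.s_dot, mul_zero])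
  · refine H.baseFree i K φ (funext fun j => ?_)
    have h := congrFun h0 j
    rw [Function.comp_apply, Pi.mul_apply, map_mul, ← Function.comp_apply (f := φ),
      comp_cremonaScale] at h
    exact (mul_eq_zero.1 h).resolve_left (isUnit_map (φ.comp const) i j).ne_zero
  · have hEs' : ∀ j k, φ (E j * s k) * ψ (E k * s j) = φ (E k * s j) * ψ (E j * s k) :=
      fun j k => by simpa only [mul_comm] using hEs k j
    have comp_mul : ∀ (φ : BiPoly →ₐ[ℂ] R) i, φ ∘ (s * (cremonaScale (const ∘ (Q i)⁻¹) * m i)) =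
        cremonaScale (algebraMap ℂ R ∘ (Q i)⁻¹) * φ ∘ (s * m i) := fun φ i => by
      have : φ ∘ const ∘ (Q i)⁻¹ = algebraMap ℂ R ∘ (Q i)⁻¹ := funext fun j => φ.commutes _
      rw [← this, ← comp_cremonaScale φ (const ∘ (Q i)⁻¹), mul_left_comm]
      exact funext fun j => map_mul φ _ _
    refine H.separates R φ ψ hEs' fun i => H.mul_cross_mul_eq_zero (hQ i) φ ψ hEs' <|
      cross_eq_zero_of_mul (isUnit_map (algebraMap ℂ R) i) ?_
    simpa only [comp_mul] using hsm i

end IsToricCurve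

theorem HasCurve.cremona_coordPt (h : HasCurve (Sum.elim coordPt Q) d (Sum.elim a b))
    (hQ : ∀ i j, Q i j ≠ 0) :
    HasCurve (Sum.elim coordPt Q⁻¹) (2 * d - ∑ j, a j)
      (Sum.elim (fun j => d - ∑ i, a i + a j) b) := by
  obtain ⟨x, e, l, h⟩ := h
  obtain ⟨s, m, h⟩ := h.exists_isToricCurve hQ
  exact ⟨_, _, _, (h.cremona hQ).isCurve⟩

end Curves

theorem HasCurve.mulVec {ι : Type*} {P : ι → Fin 3 → ℂ} {d : ℤ} {c : ι → ℤ}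
    (H : HasCurve P d c) (g h : Matrix (Fin 3) (Fin 3) ℂ) (hgh : h * g = 1) :
    HasCurve (fun i => g *ᵥ P i) d c :=
  let ⟨_, _, _, H⟩ := H
  ⟨_, _, _, H.mulVec g h hgh⟩

theorem baseFree_const {v : Fin 3 → ℂ} (hv : v ≠ 0) : BaseFree (const ∘ v) := fun _ _ φ h =>
  hv <| funext fun j => (map_eq_zero (φ.comp const)).1 (congrFun h j)

theorem hasCurve_exceptionalDivisor {κ : Type*} {p : Fin 3 → ℂ} {Q : κ → Fin 3 → ℂ} (hp : p 0 ≠ 0)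
    (hQ : ∀ i, Q i ⨯₃ p ≠ 0) :
    HasCurve (Sum.elim (fun _ : Unit => p) Q) 0 (Sum.elim (fun _ => -1) fun _ => 0) := by
  let l : Fin 3 → BiPoly := (const ∘ p) ⨯₃ ![0, T1, -T0]
  have hl1 : l 1 = const (p 0) * T0 := by simp [l, cross_apply]
  have hl2 : l 2 = const (p 0) * T1 := by simp [l, cross_apply]
  refine ⟨const ∘ p, Sum.elim 0 1, Sum.elim (fun _ => l) fun i => const ∘ (Q i ⨯₃ p),
    fun j => const_mem_sections _, ?_, ?_, ?_, ?_, ?_,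
    baseFree_const fun h => hp (congrFun h 0), ?_, fun R _ _ _ φ ψ _ h => ?_⟩
  · exact Sum.rec (fun _ => zero_mem _) fun _ => one_mem_sections
  · refine Sum.rec (fun _ j => ?_) fun i j => const_mem_sections _
    have hw : ∀ k, (![0, T1, -T0] : Fin 3 → BiPoly) k ∈ sections 1 := by
      simp [Fin.forall_fin_succ, T0_mem_sections, T1_mem_sections]
    change ((const ∘ p) ⨯₃ ![0, T1, -T0]) j ∈ sections _
    rw [cross_apply_cyclic]
    exact sub_mem (const_mul_mem_sections _ (hw _)) (const_mul_mem_sections _ (hw _))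
  · exact Sum.rec (fun _ => by simp) fun i => by simp [comp_cross]
  · refine Sum.rec (fun _ => ?_) fun i => ?_
    · exact (dotProduct_comm _ _).trans (dot_self_cross _ _)
    · exact (dotProduct_comm _ _).trans (by simp [comp_cross])
  · refine Sum.rec (fun _ => ?_) fun i => ?_
    · exact (dotProduct_comm _ _).trans (dot_self_cross _ _)
    · exact (dotProduct_comm _ _).trans (by simp [comp_cross])
  · refine Sum.rec (fun _ K _ φ h => ?_) fun i => baseFree_const (hQ i)
    have hp' : φ (const (p 0)) ≠ 0 := (map_ne_zero (φ.comp const)).2 hp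
    have h1 : φ (l 1) = 0 := congrFun h 1
    have h2 : φ (l 2) = 0 := congrFun h 2
    rw [hl1, map_mul] at h1
    rw [hl2, map_mul] at h2
    have : ((0, 1) : BiPoly) * T0 + (1, 0) * T1 = 1 := by simp [T0, T1]
    simpa [(mul_eq_zero.1 h1).resolve_left hp', (mul_eq_zero.1 h2).resolve_left hp']
      using congrArg φ this
  · have h12 := cross_eq_zero_iff.1 (h (.inl ())) 1 2
    have hu : IsUnit (algebraMap ℂ R (p 0)) := hp.isUnit.map _
    simp only [Sum.elim_inl, Function.comp_apply, hl1, hl2, map_mul, AlgHom.commutes] at h12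
    apply (hu.mul hu).mul_left_cancel
    linear_combination h12

/-! ### General position -/

section GeneralPosition

variable {V : Type*} [NormedAddCommGroup V] [NormedSpace ℂ V]

theorem dense_ne_zero_of_contDiff {f : V → ℂ} (hf : ContDiff ℂ ω f) {v : V} (hv : f v ≠ 0) :
    Dense {w | f w ≠ 0} := by
  intro w
  by_contra h
  refine hv (AnalyticOnNhd.eqOn_zero_of_preconnected_of_eventuallyEq_zero
    (fun z _ => hf.contDiffAt.analyticAt) isPreconnected_univ (Set.mem_univ w) ?_ (Set.mem_univ v))
  have : ∀ᶠ x in 𝓝 w, f x = 0 := by simpa [mem_closure_iff_frequently] using h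
  exact this

theorem isOpen_and_dense_forall_ne_zero [BaireSpace V] {α : Type*} [Finite α] {f : α → V → ℂ}
    (hf : ∀ a, ContDiff ℂ ω (f a)) (hne : ∀ a, ∃ v, f a v ≠ 0) :
    IsOpen {w | ∀ a, f a w ≠ 0} ∧ Dense {w | ∀ a, f a w ≠ 0} := by
  have ho : ∀ a, IsOpen {w | f a w ≠ 0} := fun a =>
    isOpen_ne_fun (hf a).continuous continuous_const
  rw [Set.ofPred_forall]
  exact ⟨isOpen_iInter_of_finite ho, dense_iInter_of_isOpen ho fun a =>
    let ⟨_, hv⟩ := hne a; dense_ne_zero_of_contDiff (hf a) hv⟩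

theorem contDiff_det {M : V → Matrix (Fin 3) (Fin 3) ℂ}
    (hM : ∀ i j, ContDiff ℂ ω fun v => M v i j) : ContDiff ℂ ω fun v => (M v).det := by
  simp only [det_fin_three]
  fun_prop

end GeneralPosition

/-- Configurations of points that are pairwise distinct, even under projection from `(0 : 0 : 1)`,
and do not lie on the line at infinity. -/
def distinctPoints (ι : Type*) : Set (ι → Fin 3 → ℂ) :=
  {P | ∀ i, P i 0 ≠ 0} ∩ {P | ∀ q : {q : ι × ι // q.1 ≠ q.2}, (P q.1.1 ⨯₃ P q.1.2) 2 ≠ 0}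

theorem isOpen_and_dense_distinctPoints (ι : Type*) [Finite ι] :
    IsOpen (distinctPoints ι) ∧ Dense (distinctPoints ι) := by
  classical
  cases nonempty_fintype ι
  obtain ⟨ho, hd⟩ := isOpen_and_dense_forall_ne_zero (V := ι → Fin 3 → ℂ)
    (f := fun i P => P i 0) (fun i => by fun_prop) fun i => ⟨fun _ => ![1, 0, 0], by simp⟩
  obtain ⟨ho', hd'⟩ := isOpen_and_dense_forall_ne_zero (V := ι → Fin 3 → ℂ)
    (f := fun (q : {q : ι × ι // q.1 ≠ q.2}) P => (P q.1.1 ⨯₃ P q.1.2) 2)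
    (fun q => by simp only [cross_apply_cyclic]; fun_prop) fun ⟨(i, j), hij⟩ =>
      ⟨fun k => if k = i then ![1, 0, 0] else ![0, 1, 0], by simp [cross_apply, hij.symm]⟩
  exact ⟨ho.inter ho', hd.inter_of_isOpen_left hd' ho⟩

/-! ### The Cremona transformation of configurations -/

section CremonaMap

variable {κ : Type*}

/-- The matrix of the first three points, which maps the coordinate points to them. -/
def frame (P : Fin 3 ⊕ κ → Fin 3 → ℂ) : Matrix (Fin 3) (Fin 3) ℂ := of fun i j => P (.inl j) i

theorem frame_mulVec_coordPt (P : Fin 3 ⊕ κ → Fin 3 → ℂ) (j : Fin 3) :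
    frame P *ᵥ coordPt j = P (.inl j) :=
  mulVec_single_one _ _

/-- The coordinates of the remaining points with respect to the first three. -/
noncomputable def frameCoord (P : Fin 3 ⊕ κ → Fin 3 → ℂ) : κ → Fin 3 → ℂ := fun i =>
  (frame P)⁻¹ *ᵥ P (.inr i)

/-- The configurations in which the first three points are not collinear and the other ones do not
lie on the lines through two of them. -/
def cremonaDomain (κ : Type*) : Set (Fin 3 ⊕ κ → Fin 3 → ℂ) :=
  {P | (frame P).det ≠ 0} ∩ {P | ∀ q : κ × Fin 3, (frame P).cramer (P (.inr q.1)) q.2 ≠ 0}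

theorem isOpen_and_dense_cremonaDomain (κ : Type*) [Finite κ] :
    IsOpen (cremonaDomain κ) ∧ Dense (cremonaDomain κ) := by
  cases nonempty_fintype κ
  have hframe : ∀ R, frame (Sum.elim coordPt R : Fin 3 ⊕ κ → Fin 3 → ℂ) = 1 := fun R => by
    ext i j
    simp [frame, coordPt, one_apply, Pi.single_apply]
  have hdet : ContDiff ℂ ω fun P : Fin 3 ⊕ κ → Fin 3 → ℂ => (frame P).det :=
    contDiff_det fun i j => by simp only [frame, of_apply]; fun_prop
  have ho : IsOpen {P : Fin 3 ⊕ κ → Fin 3 → ℂ | (frame P).det ≠ 0} :=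
    isOpen_ne_fun hdet.continuous continuous_const
  have hd := dense_ne_zero_of_contDiff hdet (v := Sum.elim coordPt 0) (by simp [hframe])
  obtain ⟨ho', hd'⟩ := isOpen_and_dense_forall_ne_zero (V := Fin 3 ⊕ κ → Fin 3 → ℂ)
    (f := fun (q : κ × Fin 3) P => (frame P).cramer (P (.inr q.1)) q.2)
    (fun q => by
      simp only [cramer_apply]
      refine contDiff_det fun i j => ?_
      simp only [updateCol_apply, frame, of_apply]
      split_ifs <;> fun_prop) fun ⟨i, j⟩ => ⟨Sum.elim coordPt fun _ => coordPt j, by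
        simp [hframe, coordPt]⟩
  exact ⟨ho.inter ho', hd.inter_of_isOpen_left hd' ho⟩

theorem frameCoord_eq (P : Fin 3 ⊕ κ → Fin 3 → ℂ) (i : κ) :
    frameCoord P i = (frame P).det⁻¹ • (frame P).cramer (P (.inr i)) := by
  rw [frameCoord, inv_def, Ring.inverse_eq_inv', smul_mulVec, cramer_eq_adjugate_mulVec]

theorem mem_cremonaDomain_iff {P : Fin 3 ⊕ κ → Fin 3 → ℂ} :
    P ∈ cremonaDomain κ ↔ (frame P).det ≠ 0 ∧ ∀ i j, frameCoord P i j ≠ 0 :=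
  and_congr_right fun (h : (frame P).det ≠ 0) => by simp [frameCoord_eq, h]

theorem continuous_frame : Continuous (frame (κ := κ)) :=
  continuous_matrix fun i j => by simp only [frame, of_apply]; fun_prop

theorem continuous_frameCoord (i : κ) :
    Continuous fun P : cremonaDomain κ => frameCoord P.1 i := by
  have hF : Continuous fun P : cremonaDomain κ => frame P.1 :=
    continuous_frame.comp continuous_subtype_val
  simp only [frameCoord_eq, cramer_eq_adjugate_mulVec]
  exact (hF.matrix_det.inv₀ fun P => P.2.1).smul (hF.matrix_adjugate.matrix_mulVec
    ((continuous_apply _).comp continuous_subtype_val))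

/-- The points of a configuration after the Cremona transformation based at its first three points:
these are kept, and the coordinates of the other points with respect to them are inverted. -/
noncomputable def cremonaConfig (P : Fin 3 ⊕ κ → Fin 3 → ℂ) : Fin 3 ⊕ κ → Fin 3 → ℂ :=
  Sum.elim (fun j => P (.inl j)) fun i => frame P *ᵥ (frameCoord P i)⁻¹

theorem frameCoord_cremonaConfig {P : Fin 3 ⊕ κ → Fin 3 → ℂ} (hP : (frame P).det ≠ 0) (i : κ) :
    frameCoord (cremonaConfig P) i = (frameCoord P i)⁻¹ := by
  change (frame P)⁻¹ *ᵥ frame P *ᵥ (frameCoord P i)⁻¹ = _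
  rw [mulVec_mulVec, nonsing_inv_mul _ hP.isUnit, one_mulVec]

/-- The Cremona transformation of configurations. -/
noncomputable def cremonaMap (P : cremonaDomain κ) : cremonaDomain κ :=
  ⟨cremonaConfig P.1, mem_cremonaDomain_iff.2 ⟨P.2.1, fun i j => by
    rw [frameCoord_cremonaConfig P.2.1]
    exact inv_ne_zero ((mem_cremonaDomain_iff.1 P.2).2 i j)⟩⟩

theorem involutive_cremonaMap : Function.Involutive (cremonaMap (κ := κ)) := fun P => by
  refine Subtype.ext (funext (Sum.rec (fun _ => rfl) fun i => ?_))
  change frame P.1 *ᵥ (frameCoord (cremonaConfig P.1) i)⁻¹ = P.1 (.inr i)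
  rw [frameCoord_cremonaConfig P.2.1, inv_inv, frameCoord, mulVec_mulVec,
    mul_nonsing_inv _ P.2.1.isUnit, one_mulVec]

theorem continuous_cremonaMap : Continuous (cremonaMap (κ := κ)) := by
  refine Continuous.subtype_mk (continuous_pi fun i => ?_) _
  rcases i with j | i
  · change Continuous fun P : cremonaDomain κ => P.1 (Sum.inl j)
    exact (continuous_apply _).comp continuous_subtype_val
  · have hinv : Continuous fun P : cremonaDomain κ => (frameCoord P.1 i)⁻¹ :=
      continuous_pi fun j => ((continuous_apply j).comp (continuous_frameCoord i)).inv₀ fun P =>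
        (mem_cremonaDomain_iff.1 P.2).2 i j
    exact (continuous_frame.comp continuous_subtype_val).matrix_mulVec hinv

theorem HasCurve.cremona {P : cremonaDomain κ} {d : ℤ} {a : Fin 3 → ℤ} {b : κ → ℤ}
    (h : HasCurve P.1 d (Sum.elim a b)) : HasCurve (cremonaMap P).1 (2 * d - ∑ j, a j)
      (Sum.elim (fun j => d - ∑ i, a i + a j) b) := by
  have hP := P.2.1.isUnit
  have hcoord : (fun i => (frame P.1)⁻¹ *ᵥ P.1 i) = Sum.elim coordPt (frameCoord P.1) := by
    refine funext (Sum.rec (fun j => ?_) fun _ => rfl)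
    rw [← frame_mulVec_coordPt P.1, mulVec_mulVec, nonsing_inv_mul _ hP, one_mulVec, Sum.elim_inl]
  have hmap : (fun i => frame P.1 *ᵥ (Sum.elim coordPt (frameCoord P.1)⁻¹ : Fin 3 ⊕ κ → _) i) =
      (cremonaMap P).1 := funext (Sum.rec (frame_mulVec_coordPt P.1) fun _ => rfl)
  rw [← hmap]
  refine HasCurve.mulVec (HasCurve.cremona_coordPt ?_ (mem_cremonaDomain_iff.1 P.2).2) _ _
    (nonsing_inv_mul _ hP)
  rw [← hcoord]
  exact h.mulVec _ _ (mul_nonsing_inv _ hP)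

theorem dense_hasCurve_cremona [Finite κ] {d : ℤ} {a : Fin 3 → ℤ} {b : κ → ℤ}
    (h : Dense {P : Fin 3 ⊕ κ → Fin 3 → ℂ | HasCurve P d (Sum.elim a b)}) :
    Dense {P : Fin 3 ⊕ κ → Fin 3 → ℂ |
      HasCurve P (2 * d - ∑ j, a j) (Sum.elim (fun j => d - ∑ i, a i + a j) b)} := by
  obtain ⟨hUo, hUd⟩ := isOpen_and_dense_cremonaDomain κ
  refine (hUd.denseRange_val.dense_image continuous_subtype_val
    (involutive_cremonaMap.surjective.denseRange.dense_image continuous_cremonaMap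
      (h.preimage hUo.isOpenEmbedding_subtypeVal.isOpenMap))).mono ?_
  rintro _ ⟨_, ⟨P, hP, rfl⟩, rfl⟩
  exact HasCurve.cremona hP

end CremonaMap

/-! ### Symplectic spheres from rational curves -/

section FubiniStudy

open scoped ComplexOrder

variable {u a v : Fin 3 → ℂ}

theorem re_star_dotProduct_self_nonneg (v : Fin 3 → ℂ) : 0 ≤ (star v ⬝ᵥ v).re :=
  (Complex.nonneg_iff.1 (dotProduct_star_self_nonneg v)).1

theorem re_star_dotProduct_self_eq_zero : (star v ⬝ᵥ v).re = 0 ↔ v = 0 := by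
  rw [← dotProduct_star_self_eq_zero, Complex.ext_iff, Complex.zero_re, Complex.zero_im,
    ← (Complex.nonneg_iff.1 (dotProduct_star_self_nonneg v)).2]
  simp

theorem fubiniStudy_smul_I (u a : Fin 3 → ℂ) : fubiniStudy u a (Complex.I • a) =
    (star (a ⨯₃ u) ⬝ᵥ (a ⨯₃ u)).re / (star u ⬝ᵥ u).re ^ 2 := by
  have hstar : star (a ⨯₃ u) = star a ⨯₃ star u := comp_cross (starRingEnd ℂ) a u
  have hI : (star a ⬝ᵥ Complex.I • a) * (star u ⬝ᵥ u) - (star a ⬝ᵥ u) * (star u ⬝ᵥ Complex.I • a) =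
      Complex.I * (star a ⬝ᵥ a * star u ⬝ᵥ u - star a ⬝ᵥ u * star u ⬝ᵥ a) := by
    simp only [dotProduct_smul, smul_eq_mul]
    ring
  rw [fubiniStudy, hI, Complex.I_mul_im, hstar, cross_dot_cross]

theorem fubiniStudy_smul_I_nonneg (u a : Fin 3 → ℂ) : 0 ≤ fubiniStudy u a (Complex.I • a) := by
  rw [fubiniStudy_smul_I]
  exact div_nonneg (re_star_dotProduct_self_nonneg _) (sq_nonneg _)

theorem fubiniStudy_smul_I_eq_zero (hu : u ≠ 0) :
    fubiniStudy u a (Complex.I • a) = 0 ↔ a ⨯₃ u = 0 := by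
  rw [fubiniStudy_smul_I, div_eq_zero_iff, sq_eq_zero_iff, re_star_dotProduct_self_eq_zero,
    re_star_dotProduct_self_eq_zero, or_iff_left hu]

theorem fsDensity_eval (p : Fin 3 → ℂ[X]) (z : ℂ) :
    fsDensity (fun z j => (p j).eval z) z = fubiniStudy (fun j => (p j).eval z)
      (fun j => (p j).derivative.eval z) (Complex.I • fun j => (p j).derivative.eval z) := by
  have h : HasDerivAt (fun z j => (p j).eval z) (fun j => (p j).derivative.eval z) z :=
    hasDerivAt_pi.2 fun j => (p j).hasDerivAt z
  rw [fsDensity, (h.hasFDerivAt.restrictScalars ℝ).fderiv]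
  simp

end FubiniStudy

open DualNumber in
theorem aeval_add_eps_mul_comm_iff {p q : ℂ[X]} {z : ℂ} :
    aeval (algebraMap ℂ ℂ[ε] z + ε) p * aeval (algebraMap ℂ ℂ[ε] z) q =
      aeval (algebraMap ℂ ℂ[ε] z + ε) q * aeval (algebraMap ℂ ℂ[ε] z) p ↔
    p.derivative.eval z * q.eval z = q.derivative.eval z * p.eval z := by
  have hε : (ε : ℂ[ε]) ^ 2 = 0 := by rw [sq, DualNumber.eps_mul_eps]
  simp only [aeval_add_of_sq_eq_zero _ _ _ hε, aeval_algebraMap_apply, coe_aeval_eq_eval]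
  constructor <;> intro h
  · simpa [mul_comm, TrivSqZeroExt.algebraMap_eq_inl] using congrArg TrivSqZeroExt.snd h
  · have := congrArg (algebraMap ℂ ℂ[ε]) h
    simp only [map_mul] at this
    linear_combination ε * this

/-- Evaluation at a point of the Riemann sphere. -/
noncomputable def evalAt (s : OnePoint ℂ) : BiPoly →ₐ[ℂ] ℂ :=
  s.elim ((aeval 0).comp (AlgHom.snd ℂ _ _)) fun z => (aeval z).comp (AlgHom.fst ℂ _ _)

theorem eq_of_evalAt {s t : OnePoint ℂ}
    (h : evalAt s T0 * evalAt t T1 = evalAt s T1 * evalAt t T0) : s = t := by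
  induction s using OnePoint.rec <;> induction t using OnePoint.rec <;>
    simp_all [evalAt, T0, T1]

theorem BaseFree.comp_ne_zero {A K : Type} [CommRing A] [Algebra ℂ A] [Field K] [Algebra ℂ K]
    {x : Fin 3 → A} (hx : BaseFree x) (φ : A →ₐ[ℂ] K) : φ ∘ x ≠ 0 :=
  hx K φ.toRingHom

/-- The smooth sphere in the plane whose homogeneous coordinates are given sections. -/
noncomputable def sphereOfSections (d : ℤ) (x : Fin 3 → BiPoly) (hx : ∀ j, x j ∈ sections d)
    (h0 : BaseFree x) : SmoothSphere where
  u z j := (x j).1.eval z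
  v w j := (x j).2.eval w
  smooth_u := contDiff_pi.2 fun j => (show ContDiff ℂ _ fun z => (x j).1.eval z by
    simpa using (x j).1.contDiff_aeval (𝕜 := ℂ) (R := ℂ) ∞).restrict_scalars ℝ
  smooth_v := contDiff_pi.2 fun j => (show ContDiff ℂ _ fun z => (x j).2.eval z by
    simpa using (x j).2.contDiff_aeval (𝕜 := ℂ) (R := ℂ) ∞).restrict_scalars ℝ
  u_ne_zero z := h0.comp_ne_zero ((aeval z).comp (AlgHom.fst ℂ _ _))
  v_ne_zero w := h0.comp_ne_zero ((aeval w).comp (AlgHom.snd ℂ _ _))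
  deg := d
  glue z hz := funext fun j => hx j z hz

theorem sphereOfSections_toMap {d : ℤ} {x : Fin 3 → BiPoly} (hx : ∀ j, x j ∈ sections d)
    (h0 : BaseFree x) (s : OnePoint ℂ) : (sphereOfSections d x hx h0).toMap s =
      Projectivization.mk ℂ (evalAt s ∘ x) (h0.comp_ne_zero _) := by
  induction s using OnePoint.rec <;> rfl

namespace IsCurve

variable {ι : Type*} {P : ι → Fin 3 → ℂ} {d : ℤ} {c : ι → ℤ}
  {x : Fin 3 → BiPoly} {e : ι → BiPoly} {l : ι → Fin 3 → BiPoly}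

/- A tangent vector at `z` of length zero in all the factors is a point with values in the dual
numbers that is not separated from the constant point `z`. -/
open DualNumber in
theorem density_pos [Fintype ι] (H : IsCurve P d c x e l) (π : BiPoly →ₐ[ℂ] ℂ[X]) (z : ℂ)
    (hπ : (π T0).derivative.eval z * (π T1).eval z ≠ (π T1).derivative.eval z * (π T0).eval z) :
    0 < fsDensity (fun z j => (π (x j)).eval z) z +
      ∑ i, fsDensity (fun z j => (π (l i j)).eval z) z := by
  have nonneg (y : Fin 3 → BiPoly) : 0 ≤ fsDensity (fun z j => (π (y j)).eval z) z := by
    rw [fsDensity_eval]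
    exact fubiniStudy_smul_I_nonneg _ _
  have comp_cross_comp {y : Fin 3 → BiPoly} (hy : BaseFree y)
      (h : fsDensity (fun z j => (π (y j)).eval z) z = 0) :
      ((aeval (algebraMap ℂ ℂ[ε] z + ε)).comp π ∘ y) ⨯₃
        ((aeval (algebraMap ℂ ℂ[ε] z)).comp π ∘ y) = 0 := by
    rw [fsDensity_eval] at h
    have hcross := (fubiniStudy_smul_I_eq_zero (hy.comp_ne_zero ((aeval z).comp π))).1 h
    exact cross_eq_zero_iff.2 fun i j =>
      aeval_add_eps_mul_comm_iff.2 (cross_eq_zero_iff.1 hcross i j)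
  have hl := Finset.sum_nonneg fun i (_ : i ∈ Finset.univ) => nonneg (l i)
  refine (add_nonneg (nonneg x) hl).lt_of_ne' fun h => hπ ?_
  obtain ⟨hx0, hl0⟩ := (add_eq_zero_iff_of_nonneg (nonneg x) hl).1 h
  rw [Finset.sum_eq_zero_iff_of_nonneg fun i _ => nonneg (l i)] at hl0
  exact aeval_add_eps_mul_comm_iff.1 <| H.separates ℂ[ε] _ _ (comp_cross_comp H.baseFree_x hx0)
    fun i => comp_cross_comp (H.baseFree_l i) (hl0 i (Finset.mem_univ i))

theorem representedBySymplecticSphere {c : List ℤ} {P : Fin c.length → Fin 3 → ℂ}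
    {e : Fin c.length → BiPoly} {l : Fin c.length → Fin 3 → BiPoly} (H : IsCurve P d c.get x e l)
    (hP : P ∈ distinctPoints (Fin c.length)) : RepresentedBySymplecticSphere d c := by
  have hP0 : ∀ i, P i ≠ 0 := fun i h => hP.1 i (congrFun h 0)
  have dot_evalAt {v w : Fin 3 → BiPoly} (h : v ⬝ᵥ w = 0) (s : OnePoint ℂ) :
      (evalAt s ∘ v) ⬝ᵥ (evalAt s ∘ w) = 0 := by
    simpa [dotProduct] using congrArg (evalAt s) h
  refine ⟨fun i => Projectivization.mk ℂ (P i) (hP0 i), fun i j hij => ?_,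
    sphereOfSections d x H.mem_x H.baseFree_x,
    fun i => sphereOfSections _ (l i) (H.mem_l i) (H.baseFree_l i), fun s i => ?_,
    fun s t hst => ?_, fun z => H.density_pos (AlgHom.fst ℂ _ _) z (by simp [T0, T1]),
    fun z => H.density_pos (AlgHom.snd ℂ _ _) z (by simp [T0, T1]), rfl, fun _ => rfl⟩
  · by_contra hne
    exact hP.2 ⟨(i, j), hne⟩ (congrFun
      ((Projectivization.mk_eq_mk_iff_crossProduct_eq_zero _ _).1 hij) 2)
  · simp only [sphereOfSections_toMap, Projectivization.orthogonal_mk]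
    refine ⟨?_, dot_evalAt (H.dot_x i) s⟩
    have hconst : evalAt s ∘ const ∘ P i = P i := funext fun j => (evalAt s).commutes _
    simpa only [hconst] using dot_evalAt (H.dot_point i) s
  · simp only [Prod.mk.injEq, sphereOfSections_toMap] at hst
    exact eq_of_evalAt (H.separates ℂ (evalAt s) (evalAt t)
      ((Projectivization.mk_eq_mk_iff_crossProduct_eq_zero _ _).1 hst.1) fun i =>
        (Projectivization.mk_eq_mk_iff_crossProduct_eq_zero _ _).1 (congrFun hst.2 i))

end IsCurve

/-! ### Classes given by a multiset of multiplicities -/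

theorem exists_equiv_of_map_univ_eq {ι κ α : Type*} [Fintype ι] [Fintype κ] {f : ι → α}
    {g : κ → α} (h : Finset.univ.val.map f = Finset.univ.val.map g) : ∃ σ : κ ≃ ι, f ∘ σ = g := by
  classical
  have hcard (a : α) : Fintype.card {x // g x = a} = Fintype.card {x // f x = a} := by
    have hcount := congrArg (Multiset.count a) h
    simp only [Multiset.count_map, eq_comm (a := a)] at hcount
    simpa only [Fintype.card_subtype, Finset.card_def, Finset.filter_val] using hcount.symm
  exact ⟨Equiv.ofFiberEquiv fun a => Fintype.equivOfCardEq (hcard a),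
    funext fun x => Equiv.ofFiberEquiv_map _ x⟩

theorem map_univ_sumElim {ι κ α : Type*} [Fintype ι] [Fintype κ] (f : ι → α) (g : κ → α) :
    (Finset.univ : Finset (ι ⊕ κ)).val.map (Sum.elim f g) =
      Finset.univ.val.map f + Finset.univ.val.map g := by
  rw [← Finset.univ_disjSum_univ]
  change Multiset.map _ (Multiset.map _ _ + Multiset.map _ _) = _
  rw [Multiset.map_add, Multiset.map_map, Multiset.map_map, Sum.elim_comp_inl, Sum.elim_comp_inr]

theorem dense_hasCurve_reindex {ι κ : Type*} {d : ℤ} {c : ι → ℤ} (σ : κ ≃ ι)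
    (h : Dense {P : ι → Fin 3 → ℂ | HasCurve P d c}) :
    Dense {P : κ → Fin 3 → ℂ | HasCurve P d (c ∘ σ)} := by
  have hsurj : Function.Surjective fun P : ι → Fin 3 → ℂ => P ∘ σ :=
    σ.injective.surjective_comp_right
  refine (hsurj.denseRange.dense_image (by fun_prop) h).mono ?_
  rintro _ ⟨P, hP, rfl⟩
  exact HasCurve.reindex σ hP

/-- There is an embedded rational curve of degree `d` whose multiplicities are the elements of `S`,
for a dense set of configurations of points in the plane. -/
def IsRealizable (d : ℤ) (S : Multiset ℤ) : Prop :=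
  ∃ (ι : Type) (_ : Fintype ι) (c : ι → ℤ), Finset.univ.val.map c = S ∧
    Dense {P : ι → Fin 3 → ℂ | HasCurve P d c}

namespace IsRealizable

variable {d : ℤ} {S : Multiset ℤ}

theorem dense (h : IsRealizable d S) {κ : Type*} [Fintype κ] {c : κ → ℤ}
    (hc : Finset.univ.val.map c = S) : Dense {P : κ → Fin 3 → ℂ | HasCurve P d c} := by
  obtain ⟨ι, _, c', hc', hdense⟩ := h
  obtain ⟨σ, rfl⟩ := exists_equiv_of_map_univ_eq (hc'.trans hc.symm)
  exact dense_hasCurve_reindex σ hdense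

theorem cremona {a₀ a₁ a₂ : ℤ} (h : IsRealizable d ({a₀, a₁, a₂} + S)) :
    IsRealizable (2 * d - a₀ - a₁ - a₂) ({d - a₁ - a₂, d - a₀ - a₂, d - a₀ - a₁} + S) := by
  have map_univ (a : Fin 3 → ℤ) :
      Finset.univ.val.map (Sum.elim a S.toList.get) = {a 0, a 1, a 2} + S := by
    rw [map_univ_sumElim, Fin.univ_val_map, Fin.univ_val_map, List.ofFn_get, Multiset.coe_toList]
    rfl
  have hdense := dense_hasCurve_cremona (h.dense (map_univ ![a₀, a₁, a₂]))
  simp only [Fin.sum_univ_three, cons_val] at hdense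
  rw [show 2 * d - (a₀ + a₁ + a₂) = 2 * d - a₀ - a₁ - a₂ by ring] at hdense
  refine ⟨_, inferInstance, _, ?_, hdense⟩
  rw [map_univ]
  simp only [cons_val]
  rw [show d - (a₀ + a₁ + a₂) + a₀ = d - a₁ - a₂ by ring,
    show d - (a₀ + a₁ + a₂) + a₁ = d - a₀ - a₂ by ring,
    show d - (a₀ + a₁ + a₂) + a₂ = d - a₀ - a₁ by ring]

theorem exceptionalDivisor (k : ℕ) : IsRealizable 0 ({-1} + k • {0}) := by
  refine ⟨Unit ⊕ Fin k, inferInstance, Sum.elim (fun _ => -1) fun _ => 0, ?_, ?_⟩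
  · simp [map_univ_sumElim, Multiset.nsmul_singleton]
  · refine (isOpen_and_dense_distinctPoints _).2.mono fun P hP => ?_
    have hcurve := hasCurve_exceptionalDivisor (p := P (.inl ())) (Q := P ∘ .inr) (hP.1 _)
      fun i h => hP.2 ⟨(.inr i, .inl ()), by simp⟩ (congrFun h 2)
    rwa [← Sum.elim_comp_inl_inr P]

theorem representedBySymplecticSphere {c : List ℤ} (h : IsRealizable d (c : Multiset ℤ)) :
    RepresentedBySymplecticSphere d c := by
  have hdense := h.dense (c := c.get) (by rw [Fin.univ_val_map, List.ofFn_get])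
  obtain ⟨hopen, hdistinct⟩ := isOpen_and_dense_distinctPoints (Fin c.length)
  obtain ⟨P, hP, x, e, l, hcurve⟩ := (hdistinct.inter_of_isOpen_left hdense hopen).nonempty
  exact hcurve.representedBySymplecticSphere hP

end IsRealizable

/-- The class of degree `d` with multiplicities `S` satisfies the Diophantine equations, and it is
represented by an embedded rational curve in the blow-up of general points, also when further
points of multiplicity zero are blown up.  Unlike exceptional classes, which carry an ordered list,
these are manifestly symmetric in the multiplicities, and quadratic transformations based at new
points apply to them. -/
def IsGenericallyExceptional (d : ℤ) (S : Multiset ℤ) : Prop :=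
  d ^ 2 - (S.map (· ^ 2)).sum = -1 ∧ 3 * d - S.sum = 1 ∧ ∀ k : ℕ, IsRealizable d (S + k • {0})

namespace IsGenericallyExceptional

variable {d d' m m' x x' y y' : ℤ} {S S' : Multiset ℤ}

theorem isExceptional {c : List ℤ} (h : IsGenericallyExceptional d c) : IsExceptional d c := by
  obtain ⟨hsq, hsum, hreal⟩ := h
  refine ⟨⟨by simpa using hsq, by simpa using hsum⟩,
    IsRealizable.representedBySymplecticSphere ?_⟩
  simpa using hreal 0

theorem exceptionalDivisor : IsGenericallyExceptional 0 {-1} :=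
  ⟨by simp, by simp, IsRealizable.exceptionalDivisor⟩

theorem add_zeros (h : IsGenericallyExceptional d S) (j : ℕ) :
    IsGenericallyExceptional d (S + j • {0}) := by
  obtain ⟨hsq, hsum, hreal⟩ := h
  refine ⟨?_, ?_, fun k => ?_⟩
  · simpa [Multiset.map_nsmul, Multiset.sum_nsmul] using hsq
  · simpa [Multiset.sum_nsmul] using hsum
  · rw [add_assoc, ← add_smul]
    exact hreal _

theorem cremona (a₀ a₁ a₂ : ℤ) (T : Multiset ℤ) (h : IsGenericallyExceptional d S)
    (hS : S = {a₀} + {a₁} + {a₂} + T := by module) (hd : d' = 2 * d - a₀ - a₁ - a₂ := by ring)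
    (hS' : S' = {d - a₁ - a₂} + {d - a₀ - a₂} + {d - a₀ - a₁} + T := by module) :
    IsGenericallyExceptional d' S' := by
  subst hS hd hS'
  obtain ⟨hsq, hsum, hreal⟩ := h
  simp only [Multiset.map_add, Multiset.map_singleton, Multiset.sum_add,
    Multiset.sum_singleton] at hsq hsum
  refine ⟨?_, ?_, fun k => ?_⟩
  · simp only [Multiset.map_add, Multiset.map_singleton, Multiset.sum_add, Multiset.sum_singleton]
    linear_combination hsq
  · simp only [Multiset.sum_add, Multiset.sum_singleton]
    linear_combination hsum
  · have regroup (u v w : ℤ) : {u} + {v} + {w} + T + k • {0} =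
        ({u, v, w} : Multiset ℤ) + (T + k • {0}) := by
      rw [← add_assoc]
      rfl
    rw [regroup]
    exact (regroup a₀ a₁ a₂ ▸ hreal k).cremona

/-- The composition of `j` quadratic transformations that share a base point, of multiplicity `m`,
is a de Jonquières transformation. -/
theorem deJonquieres (j : ℕ) (m x y : ℤ) (T : Multiset ℤ) (h : IsGenericallyExceptional d S)
    (hS : S = {m} + (j • {x} + j • {y}) + T := by module)
    (hx : x' = d - m - x := by ring) (hy : y' = d - m - y := by ring)
    (hd : d' = d + j * (d - m - x - y) := by push_cast; ring)
    (hm : m' = m + j * (d - m - x - y) := by push_cast; ring)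
    (hS' : S' = {m'} + (j • {x'} + j • {y'}) + T := by module) :
    IsGenericallyExceptional d' S' := by
  induction j generalizing d m T S S' with
  | zero => simp_all
  | succ j ih =>
    have hstep : IsGenericallyExceptional (2 * d - m - x - y)
        ({d - x - y} + (j • {x} + j • {y}) + ({x'} + {y'} + T)) :=
      h.cremona m x y (j • {x} + j • {y} + T) (by rw [hS]; module) rfl (by rw [hx, hy]; module)
    refine ih _ _ hstep rfl ?_ ?_ ?_ ?_ (by rw [hS']; module)
    · rw [hx]; ring
    · rw [hy]; ring
    · rw [hd]; push_cast; ring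
    · rw [hm]; push_cast; ring

theorem deJonquieres_two_mul (j : ℕ) (m x : ℤ) (T : Multiset ℤ)
    (h : IsGenericallyExceptional d S)
    (hS : S = {m} + (2 * j) • {x} + T := by module) (hx : x' = d - m - x := by ring)
    (hd : d' = d + j * (d - m - 2 * x) := by push_cast; ring)
    (hm : m' = m + j * (d - m - 2 * x) := by push_cast; ring)
    (hS' : S' = {m'} + (2 * j) • {x'} + T := by module) :
    IsGenericallyExceptional d' S' :=
  h.deJonquieres j m x x T (m' := m') (by rw [hS]; module) hx hx (by rw [hd]; ring)
    (by rw [hm]; ring) (by rw [hS']; module)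

/-- The quintic transformation with six double base points, here with five of the multiplicities
equal, is the composition of three quadratic transformations. -/
theorem quintic (a b : ℤ) {a' b' : ℤ} (T : Multiset ℤ) (h : IsGenericallyExceptional d S)
    (hS : S = 5 • {a} + {b} + T := by module) (hd : d' = 5 * d - 2 * (5 * a + b) := by ring)
    (ha : a' = 2 * d - 4 * a - b := by ring) (hb : b' = 2 * d - 5 * a := by ring)
    (hS' : S' = 5 • {a'} + {b'} + T := by module) : IsGenericallyExceptional d' S' := by
  have h₁ : IsGenericallyExceptional (2 * d - 3 * a) (3 • {d - a - a} + 2 • {a} + {b} + T) :=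
    h.cremona a a a (2 • {a} + {b} + T) (by rw [hS]; module)
  have h₂ : IsGenericallyExceptional (4 * d - 8 * a - b)
      (3 • {d - a - a} + 2 • {a'} + {b'} + T) := by
    refine h₁.cremona a a b (3 • {d - a - a} + T) (hS' := ?_)
    rw [show a' = 2 * d - 3 * a - a - b by rw [ha]; ring,
      show b' = 2 * d - 3 * a - a - a by rw [hb]; ring]
    module
  refine h₂.cremona (d - a - a) (d - a - a) (d - a - a) (2 • {a'} + {b'} + T)
    (hd := by rw [hd]; ring) (hS' := ?_)
  rw [hS', show a' = 4 * d - 8 * a - b - (d - a - a) - (d - a - a) by rw [ha]; ring]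
  module

end IsGenericallyExceptional

/-! ### Weight expansions of continued fractions -/

theorem contFrac_bounds {l : List ℕ} (hl : ∀ x ∈ l, 1 ≤ x) :
    (contFrac l).2 ≤ (contFrac l).1 ∧ 0 < (contFrac l).1 := by
  induction l with
  | nil => simp [contFrac]
  | cons b l ih =>
    obtain ⟨hb, hl⟩ := List.forall_mem_cons.1 hl
    obtain ⟨-, hpos⟩ := ih hl
    have : 1 * (contFrac l).1 ≤ b * (contFrac l).1 := Nat.mul_le_mul_right _ hb
    simp only [contFrac]
    omega

theorem contFrac_snd_pos {l : List ℕ} (hl : ∀ x ∈ l, 1 ≤ x) (hne : l ≠ []) :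
    0 < (contFrac l).2 := by
  cases l with
  | nil => exact absurd rfl hne
  | cons b l => exact (contFrac_bounds (List.forall_mem_cons.1 hl).2).2

theorem contFrac_coprime (l : List ℕ) : (contFrac l).1.Coprime (contFrac l).2 := by
  induction l with
  | nil => simp [contFrac]
  | cons b l ih =>
    rw [contFrac, Nat.coprime_mul_right_add_left]
    exact ih.symm

theorem contFrac_append_recursion {l₀ l₁ l₂ : List ℕ} {t : ℤ}
    (hfst : ((contFrac l₂).1 : ℤ) = t * (contFrac l₁).1 - (contFrac l₀).1)
    (hsnd : ((contFrac l₂).2 : ℤ) = t * (contFrac l₁).2 - (contFrac l₀).2) (pre : List ℕ) :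
    ((contFrac (pre ++ l₂)).1 : ℤ) = t * (contFrac (pre ++ l₁)).1 - (contFrac (pre ++ l₀)).1 ∧
    ((contFrac (pre ++ l₂)).2 : ℤ) = t * (contFrac (pre ++ l₁)).2 - (contFrac (pre ++ l₀)).2 := by
  induction pre with
  | nil => exact ⟨hfst, hsnd⟩
  | cons b pre ih =>
    simp only [List.cons_append, contFrac, Nat.cast_add, Nat.cast_mul]
    exact ⟨by linear_combination b * ih.1 + ih.2, ih.1⟩

theorem intWeights_zero (p : ℕ) : intWeights p 0 = [] := by
  rw [intWeights, if_pos rfl]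

theorem intWeights_of_pos (p : ℕ) {q : ℕ} (hq : 0 < q) :
    (intWeights p q : Multiset ℤ) = (p / q) • {(q : ℤ)} + (intWeights q (p % q) : Multiset ℤ) := by
  rw [intWeights, if_neg hq.ne', ← Multiset.coe_add, Multiset.nsmul_singleton]
  rfl

theorem intWeights_mul_add (b : ℕ) {p q : ℕ} (hp : 0 < p) (hq : q ≤ p) :
    (intWeights (b * p + q) p : Multiset ℤ) = b • {(p : ℤ)} + (intWeights p q : Multiset ℤ) := by
  rw [intWeights_of_pos _ hp, Nat.mul_add_mod_self_right, add_comm (b * p),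
    Nat.add_mul_div_right _ _ hp]
  rcases hq.lt_or_eq with hlt | rfl
  · rw [Nat.div_eq_of_lt hlt, Nat.mod_eq_of_lt hlt, zero_add]
  · rw [intWeights_of_pos q hp, Nat.mod_self, Nat.div_self hp, intWeights_zero]
    module

/-- The integral weight expansion of a continued fraction, without its order. -/
def weights (l : List ℕ) : Multiset ℤ := (intWeights (contFrac l).1 (contFrac l).2 : Multiset ℤ)

theorem weights_nil : weights [] = 0 := by
  simp [weights, contFrac, intWeights_zero]

theorem weights_cons (b : ℕ) {l : List ℕ} (hl : ∀ x ∈ l, 1 ≤ x) :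
    weights (b :: l) = b • {((contFrac l).1 : ℤ)} + weights l :=
  intWeights_mul_add b (contFrac_bounds hl).2 (contFrac_bounds hl).1

theorem sum_weights {l : List ℕ} (hl : ∀ x ∈ l, 1 ≤ x) :
    (weights l).sum = (contFrac l).1 + (contFrac l).2 - 1 := by
  induction l with
  | nil => simp [weights_nil, contFrac]
  | cons b l ih =>
    obtain ⟨-, hl⟩ := List.forall_mem_cons.1 hl
    simp only [weights_cons b hl, Multiset.sum_add, Multiset.sum_nsmul, Multiset.sum_singleton,
      ih hl, contFrac, nsmul_eq_mul, Nat.cast_add, Nat.cast_mul]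
    ring

/-! ### Classes of the tails of the staircases -/

/-- The class `(r - (n + 2) a, r - (n + 3) a; W)` is generically exceptional.  For the weight
expansion `W` of a tail `[{2n+5, 2n+1}^k, end]` with numerator `r` and denominator `r - (2n+3) a`,
this is the class of the staircase `S^U_ℓ`, from which those of all six staircases are obtained. -/
def IsTailClass (n : ℕ) (r a : ℤ) (W : Multiset ℤ) : Prop :=
  IsGenericallyExceptional (r - (n + 2) * a) ({r - (n + 3) * a} + W)

namespace IsTailClass

variable {n : ℕ} {r a q t v : ℤ} {W : Multiset ℤ}

theorem flip (h : IsTailClass n r a W) :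
    IsGenericallyExceptional (r + a) ({r} + (2 * n + 6) • {a} + W) :=
  (h.add_zeros (2 * (n + 3))).deJonquieres_two_mul (n + 3) (r - (n + 3) * a) 0 W
    (x' := a) (m' := r)

theorem flip_flip (h : IsTailClass n r a W) (hq : q = (2 * n + 2) * r - (2 * n + 3) * a) :
    IsGenericallyExceptional (q + r)
      ({q} + {a} + (2 * n + 4) • {r - a} + (2 * n + 1) • {r} + W) := by
  have h₁ : IsGenericallyExceptional (r + a + n * r)
      ({a + n * r} + (2 * n + 1) • {r} + (2 * n + 5) • {a} + W) :=
    (h.flip.add_zeros (2 * n)).deJonquieres_two_mul n a 0 ({r} + (2 * n + 5) • {a} + W)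
      (x' := r) (m' := a + n * r)
  subst hq
  exact h₁.deJonquieres_two_mul (n + 2) (a + n * r) a ((2 * n + 1) • {r} + {a} + W)
    (x' := r - a) (m' := (2 * n + 2) * r - (2 * n + 3) * a)

theorem next (h : IsTailClass n r a W) (hq : q = (2 * n + 2) * r - (2 * n + 3) * a) :
    IsTailClass n ((2 * n + 5) * q + r) (q + r - a)
      ((2 * n + 5) • {q} + ((2 * n + 1) • {r} + W)) :=
  (h.flip_flip hq).deJonquieres_two_mul (n + 2) a (r - a) ({q} + (2 * n + 1) • {r} + W)
    (x' := q) (m' := (2 * n + 5) * q + r - (n + 3) * (q + r - a))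

theorem upper_u (h : IsTailClass n r a W) :
    IsGenericallyExceptional ((n + 4) * r - (n + 2) * a)
      ({(n + 3) * (r - a)} + ((2 * n + 7) • {r} + W)) :=
  (h.flip.add_zeros 1).deJonquieres_two_mul (n + 3) 0 a ({r} + W)
    (x' := r) (m' := (n + 3) * (r - a))

theorem lower_l (h : IsTailClass n r a W) (hq : q = (2 * n + 2) * r - (2 * n + 3) * a) :
    IsGenericallyExceptional (5 * (n + 1) * r - (5 * n + 7) * a)
      ({n * (r - a)} + (6 • {q} + ((2 * n + 1) • {r} + W))) := by
  have h₁ : IsGenericallyExceptional ((n + 1) * r - (n - 1) * a)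
      ({n * (r - a)} + (2 * n + 1) • {r} + 6 • {a} + W) :=
    (h.flip.add_zeros 1).deJonquieres_two_mul n 0 a ({r} + 6 • {a} + W)
      (x' := r) (m' := n * (r - a))
  subst hq
  exact h₁.quintic a a ({n * (r - a)} + (2 * n + 1) • {r} + W)
    (a' := (2 * n + 2) * r - (2 * n + 3) * a) (b' := (2 * n + 2) * r - (2 * n + 3) * a)

theorem exceptional_u (h : IsTailClass n r a W) (ht : t = (2 * n + 7) * r - (2 * n + 3) * a)
    (hq : q = t + r) :
    IsGenericallyExceptional ((5 * n + 20) * r - (5 * n + 7) * a)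
      ({(n + 5) * r - n * a} + (5 • {q} + (1 • {t} + ((2 * n + 6) • {r} + W)))) := by
  have h₁ : IsGenericallyExceptional (r + 2 * a) ({r + a} + (2 * n + 8) • {a} + W) :=
    (h.flip.add_zeros 2).deJonquieres_two_mul 1 r 0 ((2 * n + 6) • {a} + W)
      (x' := a) (m' := r + a)
  have h₂ : IsGenericallyExceptional (r + 2 * a + (n + 3) * (r - a))
      ({a + (n + 3) * (r - a)} + (2 * n + 6) • {r} + {r + a} + {a} + W) :=
    h₁.deJonquieres_two_mul (n + 3) a a ({r + a} + {a} + W)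
      (x' := r) (m' := a + (n + 3) * (r - a))
  have h₃ : IsGenericallyExceptional ((n + 6) * r - (n - 1) * a)
      ({(n + 5) * r - n * a} + (2 * n + 6) • {r} + 5 • {r + a} + {a} + W) :=
    (h₂.add_zeros 4).deJonquieres_two_mul 2 (a + (n + 3) * (r - a)) 0
      ((2 * n + 6) • {r} + {r + a} + {a} + W) (x' := r + a) (m' := (n + 5) * r - n * a)
  exact h₃.quintic (r + a) a ({(n + 5) * r - n * a} + (2 * n + 6) • {r} + W)
    (a' := q) (b' := t) (ha := by rw [hq, ht]; ring) (hb := by rw [ht]; ring)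

theorem lower_u (h : IsTailClass (n + 1) r a W) (ht : t = (2 * n + 4) * r - (2 * n + 5) * a)
    (hq : q = (2 * n + 1) * t + r) :
    IsGenericallyExceptional (5 * (t + r + n * (t - r + a)) - 12 * (r - a))
      ({a + n * (t - r + a)} + (6 • {q} + ((2 * n + 1) • {t} + ((2 * n + 3) • {r} + W)))) := by
  have h₁ : IsGenericallyExceptional (t + r + n * (t - r + a))
      ({a + n * (t - r + a)} + (2 * n + 1) • {t} + 6 • {r - a} + (2 * n + 3) • {r} + W) :=
    (h.flip_flip (q := t) (by rw [ht]; push_cast; ring)).deJonquieres_two_mul n a (r - a)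
      ({t} + 6 • {r - a} + (2 * n + 3) • {r} + W) (x' := t) (m' := a + n * (t - r + a))
  exact h₁.quintic (r - a) (r - a)
    ({a + n * (t - r + a)} + (2 * n + 1) • {t} + (2 * n + 3) • {r} + W)
    (a' := q) (b' := q) (ha := by rw [hq, ht]; ring) (hb := by rw [hq, ht]; ring)

theorem exceptional_l (h : IsTailClass n r a W) (ht : t = (2 * n + 2) * r - (2 * n + 3) * a)
    (hv : v = (2 * n + 4) * t + r) (hq : q = v + t) :
    IsGenericallyExceptional ((5 * n + 10) * (t + r - a) - 2 * (r - a))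
      ({(n + 3) * (t + r - a)} +
        (5 • {q} + (1 • {v} + ((2 * n + 4) • {t} + ((2 * n + 1) • {r} + W))))) := by
  obtain ⟨g, hg⟩ : ∃ g, g = t + r - a := ⟨_, rfl⟩
  rw [← hg]
  have h₁ : IsGenericallyExceptional (g + r)
      ({g} + {r} + (2 * n + 5) • {r - a} + (2 * n + 1) • {r} + W) :=
    ((h.flip_flip ht).add_zeros 1).deJonquieres 1 t a 0
      ((2 * n + 4) • {r - a} + (2 * n + 1) • {r} + W) (x' := r - a) (y' := r) (m' := g)
      (hd := by rw [hg]; push_cast; ring) (hm := by rw [hg]; push_cast; ring)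
  have h₂ : IsGenericallyExceptional (3 * g + r) ({r + 2 * g} + 5 • {g} +
      (2 * n + 5) • {r - a} + (2 * n + 1) • {r} + W) :=
    (h₁.add_zeros 4).deJonquieres_two_mul 2 r 0
      ({g} + (2 * n + 5) • {r - a} + (2 * n + 1) • {r} + W) (x' := g) (m' := r + 2 * g)
  have h₃ : IsGenericallyExceptional ((n + 4) * g) ({(n + 3) * g} + 5 • {g} + {r - a} +
      (2 * n + 4) • {t} + (2 * n + 1) • {r} + W) :=
    h₂.deJonquieres_two_mul (n + 2) (r + 2 * g) (r - a) (5 • {g} + {r - a} + (2 * n + 1) • {r} + W)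
      (x' := t) (m' := (n + 3) * g) (hx := by rw [hg]; ring)
      (hd := by rw [hg, ht]; push_cast; ring) (hm := by rw [hg, ht]; push_cast; ring)
  exact h₃.quintic g (r - a) ({(n + 3) * g} + (2 * n + 4) • {t} + (2 * n + 1) • {r} + W)
    (a' := q) (b' := v) (ha := by rw [hq, hv, hg, ht]; ring) (hb := by rw [hv, hg, ht]; ring)

end IsTailClass

theorem isTailClass_two_mul_add_four (n : ℕ) :
    IsTailClass n (2 * n + 4) 1 ((2 * n + 4) • {1}) :=
  (IsGenericallyExceptional.exceptionalDivisor.add_zeros (2 * (n + 2))).deJonquieres_two_mul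
    (n + 2) (-1) 0 0 (x' := 1) (m' := 2 * n + 4 - (n + 3) * 1)

theorem isTailClass_two_mul_add_five_two_mul_add_two (n : ℕ) :
    IsTailClass n ((2 * n + 5) * (2 * n + 2) + 1) (2 * n + 3)
      ((2 * n + 5) • {2 * (n : ℤ) + 2} + (2 * n + 2) • {1}) := by
  have h₁ : IsGenericallyExceptional (2 * n + 3) ({2 * (n : ℤ) + 2} + (4 * n + 6) • {1}) :=
    (IsGenericallyExceptional.exceptionalDivisor.add_zeros (2 * (2 * n + 3))).deJonquieres_two_mul
      (2 * n + 3) (-1) 0 0 (x' := 1) (m' := 2 * n + 2)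
  exact (h₁.add_zeros 1).deJonquieres_two_mul (n + 2) 0 1
    ({2 * (n : ℤ) + 2} + (2 * n + 2) • {1}) (x' := 2 * n + 2)
    (m' := (2 * n + 5) * (2 * n + 2) + 1 - (n + 3) * (2 * n + 3))

/-- The properties of the tails `[{2n+5, 2n+1}^k, end]` which are preserved when `2n+5, 2n+1` is
prepended. -/
structure IsTail (n : ℕ) (l : List ℕ) (a : ℤ) : Prop where
  ne_nil : l ≠ []
  pos : ∀ x ∈ l, 1 ≤ x
  fst_eq : ((contFrac l).1 : ℤ) = (contFrac l).2 + (2 * n + 3) * a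
  isTailClass : IsTailClass n (contFrac l).1 a (weights l)

namespace IsTail

variable {n : ℕ} {l tail : List ℕ} {a : ℤ}

theorem contFrac_cons_fst (h : IsTail n l a) (b : ℕ) :
    ((contFrac (b :: l)).1 : ℤ) = (b + 1) * (contFrac l).1 - (2 * n + 3) * a := by
  simp only [contFrac, Nat.cast_add, Nat.cast_mul]
  linear_combination -h.fst_eq

theorem next (h : IsTail n l a) :
    IsTail n ((2 * n + 5) :: (2 * n + 1) :: l)
      ((contFrac ((2 * n + 1) :: l)).1 + (contFrac l).1 - a) where
  ne_nil := List.cons_ne_nil _ _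
  pos := by simpa using h.pos
  fst_eq := by
    have hq := h.contFrac_cons_fst (2 * n + 1)
    rw [contFrac, contFrac.eq_def (_ :: l)] at *
    push_cast at hq ⊢
    linear_combination hq
  isTailClass := by
    have hfst : ((contFrac ((2 * n + 5) :: (2 * n + 1) :: l)).1 : ℤ) =
        (2 * n + 5) * (contFrac ((2 * n + 1) :: l)).1 + (contFrac l).1 := by simp [contFrac]
    rw [hfst, weights_cons _ (by simpa using h.pos), weights_cons _ h.pos]
    exact h.isTailClass.next (by rw [h.contFrac_cons_fst]; push_cast; ring)

theorem exists_of_mem (ht : tail ∈ [[2 * n + 4], [2 * n + 5, 2 * n + 2]]) :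
    ∃ a, IsTail n tail a := by
  rcases List.mem_pair.1 ht with rfl | rfl
  · refine ⟨1, by simp, by simp, by simp [contFrac]; ring, ?_⟩
    rw [weights_cons _ (by simp), weights_nil]
    simpa [contFrac] using isTailClass_two_mul_add_four n
  · refine ⟨2 * n + 3, by simp, by simp, by simp [contFrac]; ring, ?_⟩
    rw [weights_cons _ (by simp), weights_cons _ (by simp), weights_nil]
    simpa [contFrac] using isTailClass_two_mul_add_five_two_mul_add_two n

end IsTail

/-- The list `{2n+5, 2n+1}^k, tail`. -/
def periodicTail (n : ℕ) (tail : List ℕ) (k : ℕ) : List ℕ :=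
  (List.replicate k [2 * n + 5, 2 * n + 1]).flatten ++ tail

theorem periodicTail_succ (n : ℕ) (tail : List ℕ) (k : ℕ) :
    periodicTail n tail (k + 1) = (2 * n + 5) :: (2 * n + 1) :: periodicTail n tail k := by
  simp [periodicTail, List.replicate_succ]

theorem IsTail.exists_periodicTail {n : ℕ} {tail : List ℕ} {a : ℤ} (h : IsTail n tail a) (k : ℕ) :
    ∃ b, IsTail n (periodicTail n tail k) b := by
  induction k with
  | zero => exact ⟨a, by simpa [periodicTail] using h⟩
  | succ k ih =>
    obtain ⟨b, hb⟩ := ih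
    rw [periodicTail_succ]
    exact ⟨_, hb.next⟩

/-! ### The staircases -/

theorem contFrac_append_periodicTail_recursion (n : ℕ) (pre tail : List ℕ) (k : ℕ) :
    ((contFrac (pre ++ periodicTail n tail (k + 2))).1 : ℤ) =
      ((2 * n + 1) * (2 * n + 5) + 2) * (contFrac (pre ++ periodicTail n tail (k + 1))).1 -
        (contFrac (pre ++ periodicTail n tail k)).1 ∧
    ((contFrac (pre ++ periodicTail n tail (k + 2))).2 : ℤ) =
      ((2 * n + 1) * (2 * n + 5) + 2) * (contFrac (pre ++ periodicTail n tail (k + 1))).2 -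
        (contFrac (pre ++ periodicTail n tail k)).2 := by
  refine contFrac_append_recursion ?_ ?_ pre <;>
  · simp only [periodicTail_succ, contFrac]
    push_cast
    ring

theorem IsGenericallyExceptional.canonical {d m : ℤ} {l : List ℕ} (hl : ∀ x ∈ l, 1 ≤ x)
    (h : IsGenericallyExceptional d ({m} + weights l)) :
    m = 3 * d - (contFrac l).1 - (contFrac l).2 := by
  have hsum := h.2.1
  rw [Multiset.sum_add, Multiset.sum_singleton, sum_weights hl] at hsum
  linarith

theorem IsGenericallyExceptional.isPerfect {d m : ℤ} {l : List ℕ} (hl : ∀ x ∈ l, 1 ≤ x)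
    (hne : l ≠ []) (h : IsGenericallyExceptional d ({m} + weights l)) :
    IsPerfect d m (contFrac l).1 (contFrac l).2 :=
  ⟨contFrac_snd_pos hl hne, contFrac_coprime l, h.isExceptional⟩

theorem StaircasePerfect.of_isTail {n : ℕ} {pre : List ℕ} {R₁ R₂ : ℤ} (hpre : ∀ x ∈ pre, 1 ≤ x)
    (H : ∀ l a, IsTail n l a → ∃ d m : ℤ,
      (2 * n + 3) * d = R₁ * (contFrac (pre ++ l)).1 + R₂ * (contFrac (pre ++ l)).2 ∧
      IsGenericallyExceptional d ({m} + weights (pre ++ l))) :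
    StaircasePerfect n pre R₁ R₂ := by
  intro tail ht
  obtain ⟨a₀, htail⟩ := IsTail.exists_of_mem ht
  choose a hseed using htail.exists_periodicTail
  choose d m hrel hclass using fun k => H _ _ (hseed k)
  have hpos (k : ℕ) : ∀ x ∈ pre ++ periodicTail n tail k, 1 ≤ x :=
    List.forall_mem_append.2 ⟨hpre, (hseed k).pos⟩
  have hm (k : ℕ) := (hclass k).canonical (hpos k)
  have hrec := contFrac_append_periodicTail_recursion n pre tail
  have hd (k : ℕ) : d (k + 2) = ((2 * n + 1) * (2 * n + 5) + 2) * d (k + 1) - d k := by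
    apply mul_left_cancel₀ (show (2 * n + 3 : ℤ) ≠ 0 by positivity)
    linear_combination hrel (k + 2) - ((2 * n + 1) * (2 * n + 5) + 2) * hrel (k + 1) + hrel k +
      R₁ * (hrec k).1 + R₂ * (hrec k).2
  have hcf : stairCF n pre tail = fun k => contFrac (pre ++ periodicTail n tail k) := by
    simp only [funext_iff, stairCF, periodicTail, List.append_assoc, implies_true]
  refine ⟨d, m, ?_⟩
  rw [hcf]
  exact
    { sigma_nonneg := by positivity
      isSquare := ⟨2 * n + 3, by ring⟩
      recursion_d := hd
      recursion_m := fun k => by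
        rw [hm, hm, hm]
        linear_combination 3 * hd k - (hrec k).1 - (hrec k).2
      recursion_p := fun k => (hrec k).1
      recursion_q := fun k => (hrec k).2
      relation := hrel
      perfect := fun k => (hclass k).isPerfect (hpos k)
        (List.append_ne_nil_of_right_ne_nil _ (hseed k).ne_nil) }

theorem staircasePerfect_lower_l (n : ℕ) :
    StaircasePerfect n [6, 2 * n + 1] (n + 1) (-(n - 1)) := by
  refine .of_isTail (by simp) fun l a h => ?_
  have hclass := h.isTailClass.lower_l (q := (contFrac ((2 * n + 1) :: l)).1)
    (by rw [h.contFrac_cons_fst]; push_cast; ring)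
  rw [← weights_cons _ h.pos, ← weights_cons _ (by simpa using h.pos)] at hclass
  refine ⟨_, _, ?_, hclass⟩
  simp only [List.cons_append, List.nil_append, contFrac]
  push_cast
  linear_combination (5 * n + 7) * h.fst_eq

theorem staircasePerfect_upper_u (n : ℕ) :
    StaircasePerfect n [2 * n + 7] (n + 2) (-(n + 4)) := by
  refine .of_isTail (by simp) fun l a h => ?_
  have hclass := h.isTailClass.upper_u
  rw [← weights_cons _ h.pos] at hclass
  refine ⟨_, _, ?_, hclass⟩
  simp only [List.cons_append, List.nil_append, contFrac]
  push_cast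
  linear_combination (n + 2) * h.fst_eq

theorem staircasePerfect_exceptional_u (n : ℕ) :
    StaircasePerfect n [5, 1, 2 * n + 6] (-(n + 4)) (11 * n + 31) := by
  refine .of_isTail (by simp) fun l a h => ?_
  have hclass := h.isTailClass.exceptional_u (t := (contFrac ((2 * n + 6) :: l)).1)
    (q := (contFrac (1 :: (2 * n + 6) :: l)).1)
    (by rw [h.contFrac_cons_fst]; push_cast; ring) (by simp [contFrac])
  rw [← weights_cons _ h.pos, ← weights_cons _ (by simpa using h.pos),
    ← weights_cons _ (by simpa using h.pos)] at hclass
  refine ⟨_, _, ?_, hclass⟩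
  simp only [List.cons_append, List.nil_append, contFrac]
  push_cast
  linear_combination (5 * n + 7) * h.fst_eq

theorem staircasePerfect_lower_u (n : ℕ) :
    StaircasePerfect (n + 1) [6, 2 * n + 1, 2 * n + 3] (-n) (11 * n + 13) := by
  refine .of_isTail (by simp) fun l a h => ?_
  have hclass := h.isTailClass.lower_u (t := (contFrac ((2 * n + 3) :: l)).1)
    (q := (contFrac ((2 * n + 1) :: (2 * n + 3) :: l)).1)
    (by rw [h.contFrac_cons_fst]; push_cast; ring) (by simp [contFrac])
  rw [← weights_cons _ h.pos, ← weights_cons _ (by simpa using h.pos),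
    ← weights_cons _ (by simpa using h.pos)] at hclass
  refine ⟨_, _, ?_, hclass⟩
  have hfst := h.fst_eq
  simp only [List.cons_append, List.nil_append, contFrac]
  push_cast at hfst ⊢
  linear_combination (-(5 * n + 12)) * hfst

theorem staircasePerfect_upper_l (n : ℕ) : StaircasePerfect n [] (n + 1) (n + 2) := by
  refine .of_isTail (by simp) fun l a h => ⟨_, _, ?_, h.isTailClass⟩
  rw [List.nil_append]
  linear_combination (n + 2) * h.fst_eq

theorem staircasePerfect_exceptional_l (n : ℕ) :
    StaircasePerfect n [5, 1, 2 * n + 4, 2 * n + 1] (n + 2) (-(n + 4)) := by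
  refine .of_isTail (by simp) fun l a h => ?_
  have hclass := h.isTailClass.exceptional_l (t := (contFrac ((2 * n + 1) :: l)).1)
    (v := (contFrac ((2 * n + 4) :: (2 * n + 1) :: l)).1)
    (q := (contFrac (1 :: (2 * n + 4) :: (2 * n + 1) :: l)).1)
    (by rw [h.contFrac_cons_fst]; push_cast; ring) (by simp [contFrac]) (by simp [contFrac])
  rw [← weights_cons _ h.pos, ← weights_cons _ (by simpa using h.pos),
    ← weights_cons _ (by simpa using h.pos), ← weights_cons _ (by simpa using h.pos)] at hclass
  refine ⟨_, _, ?_, hclass⟩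
  simp only [List.cons_append, List.nil_append, contFrac]
  push_cast
  linear_combination (5 * n + 8) * h.fst_eq

/-! ### The Fibonacci staircase -/

theorem fib_two_mul_add_five (k : ℕ) :
    Nat.fib (2 * k + 5) + Nat.fib (2 * k + 1) = 3 * Nat.fib (2 * k + 3) := by
  have h₃ : Nat.fib (2 * k + 3) = Nat.fib (2 * k + 1) + Nat.fib (2 * k + 2) := Nat.fib_add_two
  have h₄ : Nat.fib (2 * k + 4) = Nat.fib (2 * k + 2) + Nat.fib (2 * k + 3) := Nat.fib_add_two
  have h₅ : Nat.fib (2 * k + 5) = Nat.fib (2 * k + 3) + Nat.fib (2 * k + 4) := Nat.fib_add_two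
  omega

theorem fib_two_mul_add_nine (k : ℕ) :
    (Nat.fib (2 * k + 9) : ℤ) = 7 * Nat.fib (2 * k + 5) - Nat.fib (2 * k + 1) := by
  have h₀ := fib_two_mul_add_five k
  have h₁ := fib_two_mul_add_five (k + 1)
  have h₂ := fib_two_mul_add_five (k + 2)
  simp only [mul_add, add_assoc, Nat.reduceMul, Nat.reduceAdd] at h₁ h₂
  omega

theorem coprime_fib_add_four {k : ℕ} (hk : Odd k) :
    (Nat.fib (k + 4)).Coprime (Nat.fib k) := by
  have hgcd : (k + 4).gcd k = 1 := by
    rw [Nat.gcd_self_add_left]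
    exact hk.coprime_two_left.pow_left 2
  rw [Nat.Coprime, ← Nat.fib_gcd, hgcd, Nat.fib_one]

theorem intWeights_add_self (x : ℕ) {y : ℕ} (hy : 0 < y) :
    (intWeights (x + y) y : Multiset ℤ) = {(y : ℤ)} + (intWeights x y : Multiset ℤ) := by
  rw [intWeights_of_pos _ hy, intWeights_of_pos x hy, Nat.add_div_right _ hy,
    Nat.add_mod_right]
  module

theorem IsGenericallyExceptional.fibonacci_step {d r s : ℤ} {W : Multiset ℤ}
    (h : IsGenericallyExceptional d ({0} + ({s} + W))) (hr : r = 3 * d - 2 * s) :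
    IsGenericallyExceptional (3 * (r + s) - d) ({0} + (6 • {r + s} + (1 • {r} + W))) := by
  subst hr
  have h₁ : IsGenericallyExceptional (d + 3 * (d - s))
      ({3 * d - 2 * s} + 6 • {d - s} + ({0} + W)) :=
    (h.add_zeros 6).deJonquieres_two_mul 3 s 0 ({0} + W) (x' := d - s) (m' := 3 * d - 2 * s)
  exact h₁.quintic (d - s) (d - s) ({3 * d - 2 * s} + {0} + W)
    (a' := 3 * d - 2 * s + s) (b' := 3 * d - 2 * s + s)

theorem isGenericallyExceptional_two : IsGenericallyExceptional 2 ({0} + weights [5]) := by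
  rw [weights_cons _ (by simp), weights_nil]
  have h : IsGenericallyExceptional 2 ({0} + 5 • {1}) :=
    (IsGenericallyExceptional.exceptionalDivisor.add_zeros 5).quintic 0 (-1) 0
      (a' := 1) (b' := 0)
  simpa [contFrac] using h

theorem isGenericallyExceptional_five : IsGenericallyExceptional 5 ({0} + weights [6, 2]) := by
  have h₁ : IsGenericallyExceptional 1 ({0} + 2 • {1}) :=
    (IsGenericallyExceptional.exceptionalDivisor.add_zeros 2).deJonquieres_two_mul 1 (-1) 0 0
      (x' := 1) (m' := 0) (hd := rfl) (hm := rfl)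
  have h₂ : IsGenericallyExceptional 5 ({0} + (6 • {2} + 2 • {1})) :=
    (h₁.add_zeros 6).quintic 0 0 ({0} + 2 • {1}) (a' := 2) (b' := 2)
  rw [weights_cons _ (by simp), weights_cons _ (by simp), weights_nil]
  simpa [contFrac] using h₂

theorem isGenericallyExceptional_fib (k : ℕ) : IsGenericallyExceptional (Nat.fib (2 * k + 3))
    ({0} + (intWeights (Nat.fib (2 * k + 5)) (Nat.fib (2 * k + 1)) : Multiset ℤ)) := by
  induction k using Nat.twoStepInduction with
  | zero => exact isGenericallyExceptional_two
  | one => exact isGenericallyExceptional_five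
  | more k ih _ =>
    have h₅ := fib_two_mul_add_five k
    have h₇ := fib_two_mul_add_five (k + 1)
    have h₉ := fib_two_mul_add_nine k
    have hle : Nat.fib (2 * k + 1) ≤ Nat.fib (2 * k + 3) := Nat.fib_mono (by omega)
    have hpos : 0 < Nat.fib (2 * k + 1) := Nat.fib_pos.2 (by omega)
    simp only [mul_add, add_assoc, Nat.reduceMul, Nat.reduceAdd] at h₇ ⊢
    obtain ⟨r, hr⟩ : ∃ r, Nat.fib (2 * k + 5) = 1 * r + Nat.fib (2 * k + 1) :=
      ⟨Nat.fib (2 * k + 5) - Nat.fib (2 * k + 1), by omega⟩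
    have hlast : Nat.fib (2 * k + 9) = 6 * Nat.fib (2 * k + 5) + r := by omega
    have hdeg : (Nat.fib (2 * k + 7) : ℤ) =
        3 * (r + Nat.fib (2 * k + 1)) - Nat.fib (2 * k + 3) := by omega
    rw [hr, one_mul, intWeights_add_self r hpos] at ih
    rw [hlast, intWeights_mul_add 6 (by omega) (by omega), hr,
      intWeights_mul_add 1 (by omega) (by omega), hdeg]
    simpa using ih.fibonacci_step (r := r) (by omega)

theorem isPerfectPreStaircase_fib (e : ℕ) :
    IsPerfectPreStaircase 5 3 1 1
      (fun j => (Nat.fib (2 * (2 * j + e + 1) + 1) : ℤ)) (fun _ => 0)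
      (fun j => Nat.fib (2 * (2 * j + e + 2) + 1))
      (fun j => Nat.fib (2 * (2 * j + e) + 1)) where
  sigma_nonneg := by norm_num
  isSquare := ⟨3, by norm_num⟩
  recursion_d j := by convert fib_two_mul_add_nine (2 * j + e + 1) using 3 <;> ring_nf
  recursion_m _ := by simp
  recursion_p j := by convert fib_two_mul_add_nine (2 * j + e + 2) using 3 <;> ring_nf
  recursion_q j := by convert fib_two_mul_add_nine (2 * j + e) using 3 <;> ring_nf
  relation j := by
    have h : Nat.fib (2 * (2 * j + e + 2) + 1) + Nat.fib (2 * (2 * j + e) + 1) =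
      3 * Nat.fib (2 * (2 * j + e + 1) + 1) := fib_two_mul_add_five (2 * j + e)
    omega
  perfect j := ⟨Nat.fib_pos.2 (by omega), coprime_fib_add_four ⟨2 * j + e, rfl⟩,
    (isGenericallyExceptional_fib (2 * j + e)).isExceptional⟩

/-- The pre-staircases `S^L_ℓ, S^U_u, S^E_u` (`n ≥ 0`) and `S^L_u, S^U_ℓ, S^E_ℓ` (`n ≥ 1`), in this
order, are perfect.  The last clause is the Fibonacci staircase with all its steps, of which the
first family with `n = 0` is a tail; here `g k = fib (2k+1)`, the classes are
`(g (k+1), 0; g k w(g (k+2) / g k))`, and those with `k` even (`e = 0`) and those with `k` odd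
(`e = 1`) are the two intertwined pre-staircases. -/
theorem proposition3 :
    (∀ n : ℕ,
      StaircasePerfect n [6, 2 * n + 1] (n + 1) (-(n - 1)) ∧
      StaircasePerfect n [2 * n + 7] (n + 2) (-(n + 4)) ∧
      StaircasePerfect n [5, 1, 2 * n + 6] (-(n + 4)) (11 * n + 31)) ∧
    (∀ n : ℕ, 1 ≤ n →
      StaircasePerfect n [6, 2 * n - 1, 2 * n + 1] (-(n - 1)) (11 * n + 2) ∧
      StaircasePerfect n [] (n + 1) (n + 2) ∧
      StaircasePerfect n [5, 1, 2 * n + 4, 2 * n + 1] (n + 2) (-(n + 4))) ∧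
    (∀ e : ℕ, e < 2 →
      IsPerfectPreStaircase 5 3 1 1
        (fun j => (Nat.fib (2 * (2 * j + e + 1) + 1) : ℤ)) (fun _ => 0)
        (fun j => Nat.fib (2 * (2 * j + e + 2) + 1))
        (fun j => Nat.fib (2 * (2 * j + e) + 1))) := by
  refine ⟨fun n => ⟨staircasePerfect_lower_l n, staircasePerfect_upper_u n,
    staircasePerfect_exceptional_u n⟩, fun n hn => ⟨?_, staircasePerfect_upper_l n,
    staircasePerfect_exceptional_l n⟩, fun e _ => isPerfectPreStaircase_fib e⟩
  obtain ⟨n, rfl⟩ := Nat.exists_eq_add_of_le' hn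
  convert staircasePerfect_lower_u n using 1
  · rfl
  · push_cast; ring
  · push_cast; ring
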